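/- A strongly regular graph $\mathrm{srg}(v,k,\lambda,\mu)$ is a graph on $v$ vertices, neither complete nor edgeless, that is regular of valency $k$ and in which any two distinct vertices have $\lambda$ common neighbours if adjacent and $\mu$ if not. It is of negative Latin square type, with data $(u,r)$, if $(v,k,\lambda,\mu)=(u^2,\,r(u+1),\,-u+r^2+3r,\,r^2+r)$ with $u,r$ positive integers. A nonsingular quadratic form on a $2m$-dimensional space is elliptic if its largest totally singular subspaces have dimension $m-1$. Let $q$ be an odd prime power, $V$ an $8$-dimensional vector space over $\mathbb F_q$, and $Q:V\to\mathbb F_q$ a nonsingular elliptic quadratic form. Let $\gamma$ be a primitive element of $\mathbb F_{q^8}$ and put $C=\{\gamma^{j(q^2+1)+(q^2+1)/2} : 0\le j<(q^8-1)/(q^2+1)\}=C^{(q^2+1,q^8)}_{(q^2+1)/2}$. Then there is an $\mathbb F_q$-linear isomorphism $\varphi:V\to\mathbb F_{q^8}$ such that $Q(x)=\mathrm{Tr}_{q^8/q}\bigl(\varphi(x)^{q^4+1}\bigr)$ for all $x\in V$, and for every such $\varphi$ the following holds. Let $$\mathsf Q=\{x\in V\setminus\{0\} : Q(x)=0\},\qquad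 D_1=\{x\in V : Q(x)\text{ is a nonzero square}\},\qquad D_2=\varphi^{-1}(C),$$ $$D_3=V\setminus(\{0\}\cup\mathsf Q\cup D_1),\qquad D_4=\mathsf Q\setminus D_2 .$$ Then $0\notin D_i=-D_i$ for $i=1,2,3,4$, and for the Cayley graphs $G_i=\mathrm{Cay}(V,D_i)$ (so $G_1$ is the affine polar graph of $Q$): 1. $G_1,G_2,G_3,G_4$ decompose the complete graph on $V$, and each $G_i$ is an srg of negative Latin square type, with $u=q^4$ and $r=\tfrac{q^3(q-1)}2,\ q^2-1,\ \tfrac{q^3(q-1)}2,\ q^2(q-1)$ respectively. 2. The union $G_1+G_3$ is an srg of negative Latin square type, with $u=q^4$ and $r=q^3(q-1)$. The unions $G_1+G_2$ and $G_2+G_3$ are srgs of negative Latin square type, with $u=q^4$ and $r=\tfrac{q^3(q-1)}2+q^2-1$. 3. For $q=3$, the graphs $G_1+G_2$ and $G_2+G_3$ are srgs with parameters $(3^8,2870,1249,1260)$ (the parameters of de Lange's second sporadic example). -/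

import Mathlib

/-- `G` is a strongly regular graph srg `(v, k, l, m)`; as usual the complete and the edgeless graph
are excluded. -/
def IsSRG {V : Type*} [Fintype V] (G : SimpleGraph V) (v k l m : ℕ) : Prop :=
  @SimpleGraph.IsSRGWith V _ G (Classical.decRel G.Adj) v k l m ∧ G ≠ ⊥ ∧ G ≠ ⊤

/-- `G` is an srg of negative Latin square type with parameters
`(u ^ 2, r (u + 1), -u + r ^ 2 + 3 r, r ^ 2 + r)`. The third parameter is computed in `ℤ`. -/
def IsNegLatinSquareSRG {V : Type*} [Fintype V] (G : SimpleGraph V) (u r : ℕ) : Prop :=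
  ∃ l : ℕ, (l : ℤ) = -(u : ℤ) + (r : ℤ) ^ 2 + 3 * (r : ℤ) ∧
    IsSRG G (u ^ 2) (r * (u + 1)) l (r ^ 2 + r)

/-- A connection set in an additive group: it omits `0` and is closed under negation. -/
def IsConnectionSet {V : Type*} [AddGroup V] (D : Set V) : Prop :=
  (0 : V) ∉ D ∧ ∀ x, x ∈ D ↔ -x ∈ D

/-- The graphs `G i` decompose the complete graph: they are pairwise edge-disjoint and every pair of
distinct vertices is an edge of one of them. -/
def IsDecompositionOfComplete {V ι : Type*} (G : ι → SimpleGraph V) : Prop :=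
  (Pairwise fun i j => Disjoint (G i) (G j)) ∧ (⨆ i, G i) = ⊤

/-- A nonsingular elliptic quadratic form (in odd characteristic): the polar form is nondegenerate,
the dimension is even, say `2 (d + 1)`, and the largest dimension of a totally singular subspace
is `d`. -/
def IsNonsingularElliptic {K V : Type*} [Field K] [AddCommGroup V] [Module K V]
    (Q : QuadraticForm K V) : Prop :=
  Q.polarBilin.Nondegenerate ∧
    ∃ d : ℕ, Module.finrank K V = 2 * (d + 1) ∧
      IsGreatest {n : ℕ | ∃ W : Submodule K V, (∀ x ∈ W, Q x = 0) ∧ Module.finrank K W = n} d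

/-- The nonzero singular vectors of `Q`. -/
def singularVectors {K V : Type*} [Field K] [AddCommGroup V] [Module K V]
    (Q : QuadraticForm K V) : Set V :=
  {x | x ≠ 0 ∧ Q x = 0}

/-- The connection set of the affine polar graph of `Q`: the vectors at which `Q` takes a nonzero
square value. -/
def affinePolarSet {K V : Type*} [Field K] [AddCommGroup V] [Module K V]
    (Q : QuadraticForm K V) : Set V :=
  {x | Q x ≠ 0 ∧ IsSquare (Q x)}

/-- The cyclotomic class `C_i` of order `N` of a finite field `F` with primitive element `γ`. -/
def cyclotomicClass {F : Type*} [Field F] (γ : Fˣ) (N i : ℕ) : Set F :=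
  {x | ∃ j : ℕ, j < (Nat.card F - 1) / N ∧ x = (γ : F) ^ (j * N + i)}

/-!
The vertices are identified with `F`, the field of order `q ^ 8`, by means of `φ`. The norm
`N x = x ^ (q ^ 4 + 1)` maps `F` to its subfield `M` of order `q ^ 4`, and `Q` becomes
`Tr (N x)`. The second connection set consists of the nonzero `x` for which `N x` has relative
trace zero over the subfield `L` of order `q ^ 2` (`cyclotomicClass_eq_relSingular`), so it is the
set of singular vectors of an elliptic form over `L`, and it lies among the singular vectors of `Q`.

A Cayley graph on an abelian group of order `u ^ 2` is strongly regular of negative Latin square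
type as soon as each nontrivial character sum of its connection set is `r` or `r - u`, the trivial
one being `r (u + 1)`; this is Fourier inversion applied to the number of representations of a
vertex as a sum of two elements of the connection set
(`HasNegLatinSpectrum.isNegLatinSquareSRG`). It is not enough that the four connection sets have
such character sums, since the value `r - u` could be taken twice at the same character.
So the dual set, where `r - u` is taken, is recorded along with `r`. If the dual sets are disjoint,
unions of connection sets again have the required character sums (`HasNegLatinSpectrum.union`),
and so has the complement of the union (`HasNegLatinSpectrum.compl`).

The character sums all come from one evaluation: for an additive character `Ψ` of `F` that factors
through the trace and a nonzero `c` in `M`, the sum of `Ψ (c N x)` over `F` is `-q ^ 4`, because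
`N` is `q ^ 4 + 1` to one on nonzero elements (`sum_traceChar_norm`). Completing the square and
summing over `c` in `L` gives the second set, which is its own dual (`relSingular_spectrum`);
summing over `c` in `K`, with and without the quadratic character, gives the first and third sets,
whose duals are the sets where `-Q` is a nonzero square or a nonsquare
(`normTraceClass_spectrum`). These three duals are disjoint.

That a suitable `φ` exists follows from the classification of quadratic forms over finite fields
by their discriminant. A form in eight variables with square discriminant is a sum of eight
squares. It has a totally singular subspace of dimension four, so it is not elliptic, and its Gauss
sum is `q ^ 4`, so it is not the form `Tr (N x)`. Hence both `Q` and `Tr (N x)` have nonsquare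
discriminant and are equivalent (`exists_linearEquiv_normTrace`).
-/

/-! ### Character sums and strongly regular Cayley graphs -/

open scoped Classical in
/-- The sum of the character `χ` over the set `D`. -/
noncomputable def charSum {X E : Type*} [AddCommGroup X] [Fintype X] [Field E]
    (χ : AddChar X E) (D : Set X) : E :=
  ∑ x, if x ∈ D then χ x else 0

open scoped Classical in
/-- The characters `χ w` of `X`, with `χ 0` trivial, satisfy both orthogonality relations, so that
`w ↦ charSum (χ w) D` is the Fourier transform of the indicator function of `D`. -/
structure IsOrthogonalFamily {X W E : Type*} [AddCommGroup X] [Fintype X] [Fintype W] [Zero W]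
    [Field E] (χ : W → AddChar X E) : Prop where
  zero_apply : ∀ x, χ 0 x = 1
  sum_index : ∀ x, ∑ w, χ w x = if x = 0 then (Fintype.card X : E) else 0
  sum_group : ∀ w, ∑ x, χ w x = if w = 0 then (Fintype.card X : E) else 0

open scoped Classical in
/-- The character sums of `D` are those of a connection set of negative Latin square type: over
`D` the trivial character sums to `r * (u + 1)`, the characters indexed by the dual set `D'` sum
to `r - u`, and all others sum to `r`. -/
def HasNegLatinSpectrum {X W E : Type*} [AddCommGroup X] [Fintype X] [Zero W]
    [Field E] (χ : W → AddChar X E) (D : Set X) (D' : Set W) (u r : ℕ) : Prop :=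
  (0 : W) ∉ D' ∧ ∀ w, charSum (χ w) D =
    (r : E) - (if w ∈ D' then (u : E) else 0) + (if w = 0 then (r : E) * u else 0)

lemma isSRG_of_natCard {X : Type*} [Fintype X] {G : SimpleGraph X} {v k l m : ℕ}
    (hv : Fintype.card X = v) (hk : ∀ x, Nat.card (G.neighborSet x) = k)
    (hl : ∀ x y, G.Adj x y → Nat.card (G.commonNeighbors x y) = l)
    (hm : ∀ x y, x ≠ y → ¬ G.Adj x y → Nat.card (G.commonNeighbors x y) = m)
    (hbot : G ≠ ⊥) (htop : G ≠ ⊤) : IsSRG G v k l m := by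
  classical
  let := Classical.decRel G.Adj
  refine ⟨⟨hv, ?_, ?_, ?_⟩, hbot, htop⟩
  · intro x
    rw [← hk x, Nat.card_eq_fintype_card, SimpleGraph.card_neighborSet_eq_degree]
  · intro x y hxy
    rw [← hl x y hxy, Nat.card_eq_fintype_card]
  · intro x y hxy hn
    rw [← hm x y hxy hn, Nat.card_eq_fintype_card]

section Cayley

variable {X W E : Type*} [AddCommGroup X] [Fintype X] [Fintype W] [Zero W] [Field E]
  {χ : W → AddChar X E} {D D₁ D₂ : Set X} {D' D₁' D₂' : Set W} {u r r₁ r₂ : ℕ}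

omit [Fintype X] in
lemma addCayley_adj_iff (hD : IsConnectionSet D) (x y : X) :
    (SimpleGraph.addCayley D).Adj x y ↔ y - x ∈ D := by
  rw [SimpleGraph.addCayley_adj']
  constructor
  · rintro ⟨-, g, hg, h | h⟩
    · rwa [← h, add_sub_cancel_left]
    · rw [hD.2, h]
      simpa using hg
  · intro h
    refine ⟨?_, y - x, h, Or.inl (by abel)⟩
    rintro rfl
    exact hD.1 (by simpa using h)

omit [Fintype W] in
lemma HasNegLatinSpectrum.union (h₁ : HasNegLatinSpectrum χ D₁ D₁' u r₁)
    (h₂ : HasNegLatinSpectrum χ D₂ D₂' u r₂) (hD : Disjoint D₁ D₂) (hD' : Disjoint D₁' D₂') :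
    HasNegLatinSpectrum χ (D₁ ∪ D₂) (D₁' ∪ D₂') u (r₁ + r₂) := by
  classical
  refine ⟨fun h => h.elim h₁.1 h₂.1, fun w => ?_⟩
  have hs : charSum (χ w) (D₁ ∪ D₂) = charSum (χ w) D₁ + charSum (χ w) D₂ := by
    simp only [charSum, ← Finset.sum_add_distrib]
    refine Finset.sum_congr rfl fun x _ => ?_
    by_cases hx : x ∈ D₁
    · simp [hx, Set.disjoint_left.1 hD hx]
    · simp [hx]
  rw [hs, h₁.2 w, h₂.2 w]
  by_cases hw : w ∈ D₁'
  · have := Set.disjoint_left.1 hD' hw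
    have hw0 : w ≠ 0 := fun h => h₁.1 (h ▸ hw)
    simp [hw, this, hw0]; ring
  · by_cases hw0 : w = 0
    · simp [hw0, h₁.1, h₂.1]
      ring
    · by_cases hw' : w ∈ D₂'
      · simp [hw, hw0, hw']
        ring
      · simp [hw, hw0, hw']

lemma HasNegLatinSpectrum.compl (hχ : IsOrthogonalFamily χ) (hX : Fintype.card X = u ^ 2)
    (h : HasNegLatinSpectrum χ D D' u r₁) (h0 : (0 : X) ∉ D) (hr : r₁ + r₂ + 1 = u) :
    HasNegLatinSpectrum χ {x | x ≠ 0 ∧ x ∉ D} {w | w ≠ 0 ∧ w ∉ D'} u r₂ := by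
  classical
  refine ⟨fun h => h.1 rfl, fun w => ?_⟩
  have hs : charSum (χ w) {x | x ≠ 0 ∧ x ∉ D} = ∑ x, χ w x - 1 - charSum (χ w) D := by
    have h1 : (1 : E) = ∑ x, if x = 0 then χ w x else 0 := by simp
    rw [h1]
    simp only [charSum, ← Finset.sum_sub_distrib]
    refine Finset.sum_congr rfl fun x _ => ?_
    by_cases hx : x = 0
    · simp [hx, h0]
    · by_cases hx' : x ∈ D <;> simp [hx, hx']
  have hr' : (u : E) = r₁ + r₂ + 1 := by rw [← hr]; push_cast; ring
  rw [hs, h.2 w, hχ.sum_group w, hX]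
  by_cases hw0 : w = 0
  · simp [hw0, h.1]; rw [hr']; ring
  · by_cases hw' : w ∈ D' <;> simp [hw0, hw'] <;> rw [hr'] <;> ring

omit [Fintype W] [Zero W] in
lemma charSum_preimage {Y : Type*} [AddCommGroup Y] [Fintype Y] (e : Y ≃+ X) (θ : AddChar X E)
    (D : Set X) : charSum (θ.compAddMonoidHom e.toAddMonoidHom) (e ⁻¹' D) = charSum θ D := by
  classical
  exact Equiv.sum_comp e.toEquiv fun x => if x ∈ D then θ x else 0

omit [Fintype W] in
lemma HasNegLatinSpectrum.preimage {Y : Type*} [AddCommGroup Y] [Fintype Y] (e : Y ≃+ X)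
    (h : HasNegLatinSpectrum χ D D' u r) :
    HasNegLatinSpectrum (fun w => (χ w).compAddMonoidHom e.toAddMonoidHom) (e ⁻¹' D) D' u r :=
  ⟨h.1, fun w => by rw [charSum_preimage, h.2 w]⟩

lemma IsOrthogonalFamily.preimage {Y : Type*} [AddCommGroup Y] [Fintype Y] (e : Y ≃+ X)
    (h : IsOrthogonalFamily χ) :
    IsOrthogonalFamily fun w => (χ w).compAddMonoidHom e.toAddMonoidHom := by
  classical
  have hcard : Fintype.card Y = Fintype.card X := Fintype.card_congr e.toEquiv
  refine ⟨fun y => h.zero_apply (e y), fun y => ?_, fun w => ?_⟩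
  · rw [hcard, ← if_congr (e.map_eq_zero_iff (x := y)) rfl rfl]
    exact h.sum_index (e y)
  · rw [hcard, ← h.sum_group w]
    exact Equiv.sum_comp e.toEquiv fun x => χ w x

omit [Fintype X] in
lemma IsConnectionSet.union (h₁ : IsConnectionSet D₁) (h₂ : IsConnectionSet D₂) :
    IsConnectionSet (D₁ ∪ D₂) :=
  ⟨fun h => h.elim h₁.1 h₂.1, fun x => or_congr (h₁.2 x) (h₂.2 x)⟩

omit [Fintype X] in
lemma IsConnectionSet.compl (h : IsConnectionSet D) :
    IsConnectionSet {x | x ≠ 0 ∧ x ∉ D} :=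
  ⟨fun h => h.1 rfl, fun x => and_congr (not_congr neg_eq_zero.symm) (not_congr (h.2 x))⟩

omit [Fintype X] in
/-- Cayley graphs on the parts of a partition of the nonzero elements decompose the complete
graph. -/
lemma isDecompositionOfComplete_addCayley {ι : Type*} {S : ι → Set X}
    (hS : ∀ i, IsConnectionSet (S i)) (hdisj : Pairwise fun i j => Disjoint (S i) (S j))
    (hunion : ∀ x ≠ 0, ∃ i, x ∈ S i) :
    IsDecompositionOfComplete fun i => SimpleGraph.addCayley (S i) := by
  refine ⟨fun i j hij => ?_, ?_⟩
  · refine disjoint_iff_inf_le.2 ?_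
    intro x y hxy
    exact Set.disjoint_left.1 (hdisj hij) ((addCayley_adj_iff (hS i) x y).1 hxy.1)
      ((addCayley_adj_iff (hS j) x y).1 hxy.2)
  · refine top_le_iff.1 fun x y hxy => ?_
    obtain ⟨i, hi⟩ := hunion (y - x) fun h => hxy (sub_eq_zero.1 h).symm
    exact SimpleGraph.iSup_adj.2 ⟨i, (addCayley_adj_iff (hS i) x y).2 hi⟩

open scoped Classical in
/-- The number of ways to write `g` as a sum of two elements of `D`. On the Fourier side the claim
is that `charSum (χ w) D` is a root of `X ^ 2 - (2 r - u) X - r (u - r)` for `w ≠ 0`. -/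
lemma HasNegLatinSpectrum.card_sum_eq [CharZero E] (hχ : IsOrthogonalFamily χ)
    (hX : Fintype.card X = u ^ 2)
    (h : HasNegLatinSpectrum χ D D' u r) (g : X) :
    (Nat.card {a // a ∈ D ∧ g - a ∈ D} : ℤ) =
      (r : ℤ) ^ 2 + r + (if g ∈ D then 2 * (r : ℤ) - u else 0) +
        (if g = 0 then (r : ℤ) * (u - r) else 0) := by
  classical
  have hu : u ≠ 0 := by
    rintro rfl
    simp at hX
  suffices H : ((u : E) ^ 2) * (Nat.card {a // a ∈ D ∧ g - a ∈ D} : E) = (u : E) ^ 2 *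
      ((r : E) ^ 2 + r + (if g ∈ D then 2 * (r : E) - u else 0) +
        (if g = 0 then (r : E) * (u - r) else 0)) by
    have := mul_left_cancel₀ (pow_ne_zero 2 (Nat.cast_ne_zero.2 hu)) H
    have h2 : (((Nat.card {a // a ∈ D ∧ g - a ∈ D} : ℤ)) : E) =
      (((r : ℤ) ^ 2 + r + (if g ∈ D then 2 * (r : ℤ) - u else 0) +
        (if g = 0 then (r : ℤ) * (u - r) else 0) : ℤ) : E) := by
      push_cast
      rw [this]
    exact_mod_cast h2
  -- inverse Fourier transforms, evaluated at `g`, of the functions of `w` in `key`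
  have e1 : ∑ w, charSum (χ w) D ^ 2 * χ w (-g) =
      (u : E) ^ 2 * (Nat.card {a // a ∈ D ∧ g - a ∈ D} : E) := by
    have : ∀ w, charSum (χ w) D ^ 2 * χ w (-g) =
        ∑ a, ∑ b, if a ∈ D ∧ b ∈ D then χ w (a + b - g) else 0 := by
      intro w
      rw [sq, charSum, Finset.sum_mul_sum, Finset.sum_mul]
      refine Finset.sum_congr rfl fun a _ => ?_
      rw [Finset.sum_mul]
      refine Finset.sum_congr rfl fun b _ => ?_
      by_cases ha : a ∈ D <;> by_cases hb : b ∈ D <;>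
        simp [ha, hb, sub_eq_add_neg, AddChar.map_add_eq_mul]
    simp only [this]
    rw [Finset.sum_comm]
    have h2 : ∀ a, ∑ w, ∑ b, (if a ∈ D ∧ b ∈ D then χ w (a + b - g) else 0) =
        if a ∈ D ∧ g - a ∈ D then (u : E) ^ 2 else 0 := by
      intro a
      rw [Finset.sum_comm]
      have h3 : ∀ b, ∑ w, (if a ∈ D ∧ b ∈ D then χ w (a + b - g) else 0) =
          if b = g - a then (if a ∈ D ∧ g - a ∈ D then (u : E) ^ 2 else 0) else 0 := by
        intro b
        by_cases hab : a ∈ D ∧ b ∈ D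
        · simp only [hab, and_self, if_true, hχ.sum_index, hX]
          by_cases hb : b = g - a
          · subst hb
            simp [hab.2]
          · have : ¬ (a + b - g = 0) := fun h0 => hb (by
              rw [← sub_eq_zero, ← h0]; abel)
            simp [hb, this]
        · simp only [hab, if_false, Finset.sum_const_zero]
          by_cases hb : b = g - a
          · subst hb; simp [hab]
          · simp [hb]
      simp only [h3]
      simp
    simp only [h2]
    rw [Nat.card_eq_fintype_card, Fintype.card_subtype, ← Finset.sum_filter, Finset.sum_const,
      nsmul_eq_mul, mul_comm]
  have e2 : ∑ w, charSum (χ w) D * χ w (-g) = (u : E) ^ 2 * if g ∈ D then 1 else 0 := by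
    simp only [charSum, Finset.sum_mul]
    rw [Finset.sum_comm]
    have h3 : ∀ b, ∑ w, (if b ∈ D then χ w b else 0) * χ w (-g) =
        if b = g then (u : E) ^ 2 * (if g ∈ D then 1 else 0) else 0 := by
      intro b
      have : ∀ w, (if b ∈ D then χ w b else 0) * χ w (-g) =
          if b ∈ D then χ w (b - g) else 0 := by
        intro w
        by_cases hb : b ∈ D <;> simp [hb, sub_eq_add_neg, AddChar.map_add_eq_mul]
      simp only [this]
      by_cases hbg : b = g
      · subst hbg
        by_cases hb : b ∈ D <;> simp only [hb, sub_self, if_true, if_false, mul_one, mul_zero,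
          Finset.sum_const_zero]
        simpa [hX] using hχ.sum_index 0
      · by_cases hb : b ∈ D <;> simp [hb, hbg, hχ.sum_index, sub_eq_zero]
    simp only [h3]
    simp
  have e3 : ∑ w, χ w (-g) = (u : E) ^ 2 * if g = 0 then 1 else 0 := by
    simp [hχ.sum_index, hX]
  have e4 : ∑ w, (if w = 0 then (1 : E) else 0) * χ w (-g) = 1 := by
    simp [hχ.zero_apply]
  have key : ∀ w, charSum (χ w) D ^ 2 * χ w (-g) =
      (2 * (r : E) - u) * (charSum (χ w) D * χ w (-g)) + (r * (u - r)) * χ w (-g) +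
      ((u : E) ^ 2 * (r ^ 2 + r)) * ((if w = 0 then (1 : E) else 0) * χ w (-g)) := by
    intro w
    rw [h.2 w]
    by_cases hw0 : w = 0
    · simp [hw0, h.1]; ring
    · by_cases hw' : w ∈ D' <;> simp [hw0, hw'] <;> ring
  rw [← e1]
  simp only [key, Finset.sum_add_distrib, ← Finset.mul_sum, e2, e3, e4]
  split_ifs <;> ring

/-- A connection set with the character sums of negative Latin square type gives a strongly
regular Cayley graph of that type. -/
theorem HasNegLatinSpectrum.isNegLatinSquareSRG [CharZero E] (hχ : IsOrthogonalFamily χ)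
    (hX : Fintype.card X = u ^ 2) (hD : IsConnectionSet D) (h : HasNegLatinSpectrum χ D D' u r)
    (hr : 0 < r) (hru : r + 1 < u) :
    IsNegLatinSquareSRG (SimpleGraph.addCayley D) u r := by
  classical
  have hcard : Nat.card {a // a ∈ D} = r * (u + 1) := by
    have := h.2 0
    simp only [charSum, hχ.zero_apply, h.1, if_false, if_true] at this
    rw [← Finset.sum_filter, Finset.sum_const, nsmul_eq_mul, mul_one,
      ← Fintype.card_subtype, ← Nat.card_eq_fintype_card] at this
    have h2 : ((Nat.card {a // a ∈ D} : ℕ) : E) = ((r * (u + 1) : ℕ) : E) := by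
      rw [this]; push_cast; ring
    exact_mod_cast h2
  have hcn : ∀ x y : X, Nat.card ((SimpleGraph.addCayley D).commonNeighbors x y) =
      Nat.card {a // a ∈ D ∧ (y - x) - a ∈ D} := by
    intro x y
    refine Nat.card_congr ((Equiv.subRight x).subtypeEquiv fun z => ?_)
    rw [SimpleGraph.mem_commonNeighbors, addCayley_adj_iff hD, addCayley_adj_iff hD, hD.2 (z - y)]
    simp
  obtain ⟨g, hg⟩ : ∃ g, g ∈ D := by
    by_contra! hne
    have : IsEmpty {a // a ∈ D} := ⟨fun a => hne a a.2⟩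
    rw [Nat.card_of_isEmpty] at hcard
    have : 0 < r * (u + 1) := by positivity
    omega
  obtain ⟨g', hg0', hg'⟩ : ∃ g, g ≠ 0 ∧ g ∉ D := by
    by_contra! hne
    have h1 : Nat.card {a // a ∈ D} + 1 = u ^ 2 := by
      have : Nat.card {a // a ∈ D} = Nat.card {a : X // ¬ (a = 0)} :=
        Nat.card_congr (Equiv.subtypeEquivRight fun a =>
          ⟨fun ha h0 => hD.1 (h0 ▸ ha), fun h0 => hne a h0⟩)
      rw [this, Nat.card_eq_fintype_card, Fintype.card_subtype_compl, Fintype.card_subtype_eq, hX]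
      have : 0 < u ^ 2 := by rw [← hX]; exact Fintype.card_pos
      omega
    rw [hcard] at h1
    nlinarith
  have hne0 : ∀ {x y : X}, x ≠ y → y - x ≠ 0 := fun hxy h0 => hxy (sub_eq_zero.1 h0).symm
  refine ⟨Nat.card {a // a ∈ D ∧ g - a ∈ D}, ?_, isSRG_of_natCard hX ?_ ?_ ?_ ?_ ?_⟩
  · rw [h.card_sum_eq hχ hX, if_pos hg, if_neg fun h0 : g = 0 => hD.1 (h0 ▸ hg)]
    ring
  · intro x
    rw [← hcard]
    refine Nat.card_congr ((Equiv.subRight x).subtypeEquiv fun z => ?_)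
    rw [SimpleGraph.mem_neighborSet, addCayley_adj_iff hD]
    simp
  · intro x y hxy
    rw [hcn, ← Nat.cast_inj (R := ℤ), h.card_sum_eq hχ hX,
      h.card_sum_eq hχ hX, if_pos hg, if_neg fun h0 : g = 0 => hD.1 (h0 ▸ hg), if_neg (hne0 hxy.ne),
      if_pos ((addCayley_adj_iff hD x y).1 hxy)]
  · intro x y hxy hn
    rw [hcn, ← Nat.cast_inj (R := ℤ), h.card_sum_eq hχ hX,
      if_neg (hne0 hxy), if_neg (mt (addCayley_adj_iff hD x y).2 hn)]
    push_cast
    ring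
  · intro hb
    have := (addCayley_adj_iff hD 0 g).2 (by simpa using hg)
    rw [hb] at this
    exact this
  · intro ht
    refine hg' ?_
    have := (addCayley_adj_iff hD 0 g').1 (by rw [ht]; exact hg0'.symm)
    simpa using this

end Cayley

/-! ### Gauss sums of the norm form -/

section Frobenius

variable {K F : Type*} [Field K] [Fintype K] [Field F] [Fintype F] [Algebra K F]

local notation "q" => Fintype.card K

lemma frob_add (n : ℕ) (x y : F) : (x + y) ^ q ^ n = x ^ q ^ n + y ^ q ^ n := by
  have h := fun z => congrFun (FiniteField.coe_frobeniusAlgEquivOfAlgebraic_iterate K F n) z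
  beta_reduce at h
  rw [← h, ← h, ← h]
  rw [← AlgEquiv.coe_pow, map_add]

lemma trace_frob (n : ℕ) (x : F) : Algebra.trace K F (x ^ q ^ n) = Algebra.trace K F x := by
  have h := congrFun (FiniteField.coe_frobeniusAlgEquivOfAlgebraic_iterate K F n) x
  beta_reduce at h
  rw [← h, ← AlgEquiv.coe_pow]
  exact Algebra.trace_eq_of_algEquiv _ x

omit [Field K] [Fintype F] [Algebra K F] in
lemma frob_frob (m n : ℕ) (x : F) : (x ^ q ^ m) ^ q ^ n = x ^ q ^ (m + n) := by
  rw [← pow_mul, ← pow_add]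

omit [Fintype F] in
lemma frob_algebraMap (n : ℕ) (c : K) : (algebraMap K F c) ^ q ^ n = algebraMap K F c := by
  rw [← map_pow, FiniteField.pow_card_pow]

omit [Fintype F] [Algebra K F] in
lemma frob_zero (n : ℕ) : (0 : F) ^ q ^ n = 0 :=
  zero_pow (pow_ne_zero _ Fintype.card_ne_zero)

lemma frob_neg (n : ℕ) (x : F) : (-x) ^ q ^ n = -x ^ q ^ n := by
  have := frob_add (K := K) n x (-x)
  rw [add_neg_cancel, frob_zero] at this
  exact (neg_eq_of_add_eq_zero_right this.symm).symm

variable (hF : Module.finrank K F = 8)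
include hF

lemma card_eq_pow_eight : Fintype.card F = q ^ 8 := by
  rw [Module.card_eq_pow_finrank (K := K) (V := F), hF]

lemma frob_eight (n : ℕ) (x : F) : x ^ q ^ (n + 8) = x ^ q ^ n := by
  rw [add_comm, ← frob_frob, ← card_eq_pow_eight hF, FiniteField.pow_card]

lemma trace_frob_mul {m n : ℕ} (hmn : m + n = 8) (x y : F) :
    Algebra.trace K F (x ^ q ^ m * y) = Algebra.trace K F (x * y ^ q ^ n) := by
  rw [← trace_frob n, mul_pow, frob_frob, hmn, ← zero_add 8, frob_eight hF]
  simp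

lemma card_units_eq : Nat.card Fˣ = q ^ 8 - 1 := by
  rw [Nat.card_units, Nat.card_eq_fintype_card, card_eq_pow_eight hF]

lemma card_ker_pow {d : ℕ} (hd : d ∣ q ^ 8 - 1) :
    Nat.card (powMonoidHom d : Fˣ →* Fˣ).ker = d := by
  rw [IsCyclic.card_powMonoidHom_ker, card_units_eq hF, Nat.gcd_eq_right hd]

end Frobenius

lemma pow_eight_sub_one_eq (q : ℕ) : q ^ 8 - 1 = (q ^ 4 + 1) * (q ^ 4 - 1) := by
  rw [← Nat.sq_sub_sq (q ^ 4) 1]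
  ring_nf

lemma pow_four_sub_one_eq (q : ℕ) : q ^ 4 - 1 = (q ^ 2 + 1) * (q ^ 2 - 1) := by
  rw [← Nat.sq_sub_sq (q ^ 2) 1]
  ring_nf

section Frobenius

variable {K F : Type*} [Field K] [Fintype K] [Field F] [Fintype F] [Algebra K F]

local notation "q" => Fintype.card K

omit [Fintype F] [Algebra K F] in
lemma frob_eq_self_iff_of_unit (d : ℕ) (u : Fˣ) :
    (u : F) ^ q ^ d = u ↔ u ∈ (powMonoidHom (q ^ d - 1) : Fˣ →* Fˣ).ker := by
  have h : q ^ d = (q ^ d - 1) + 1 :=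
    (Nat.sub_add_cancel (Nat.one_le_pow _ _ Fintype.card_pos)).symm
  rw [MonoidHom.mem_ker, powMonoidHom_apply]
  conv_lhs => rw [h, pow_succ]
  rw [← Units.val_pow_eq_pow_val, ← Units.val_mul, Units.val_inj, mul_eq_right]

variable (hF : Module.finrank K F = 8)
include hF

/-- The fixed field of the square of the Frobenius has `q ^ 2` elements. -/
lemma card_fixed_two [DecidableEq F] :
    (Finset.univ.filter fun c : F => c ^ q ^ 2 = c).card = q ^ 2 := by
  have hd : q ^ 2 - 1 ∣ q ^ 8 - 1 := by
    rw [pow_eight_sub_one_eq, pow_four_sub_one_eq]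
    exact (Dvd.intro_left _ rfl).mul_left _
  have h1 := card_ker_pow hF hd
  have h2 : (Finset.univ.filter fun c : F => c ^ q ^ 2 = c) =
      insert 0 ((Finset.univ.filter fun u : Fˣ =>
        u ∈ (powMonoidHom (q ^ 2 - 1) : Fˣ →* Fˣ).ker).map ⟨Units.val, Units.val_injective⟩) := by
    ext c
    simp only [Finset.mem_filter, Finset.mem_univ, true_and, Finset.mem_insert, Finset.mem_map,
      Function.Embedding.coeFn_mk]
    constructor
    · intro hc
      by_cases h0 : c = 0
      · exact Or.inl h0
      · exact Or.inr ⟨Units.mk0 c h0, (frob_eq_self_iff_of_unit 2 (Units.mk0 c h0)).1 hc, rfl⟩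
    · rintro (rfl | ⟨u, hu, rfl⟩)
      · exact frob_zero 2
      · exact (frob_eq_self_iff_of_unit 2 u).2 hu
  rw [h2, Finset.card_insert_of_notMem (by simp), Finset.card_map, ← Fintype.card_subtype,
    ← Nat.card_eq_fintype_card]
  have : 1 ≤ q ^ 2 := Nat.one_le_pow _ _ Fintype.card_pos
  change Nat.card (powMonoidHom (q ^ 2 - 1) : Fˣ →* Fˣ).ker + 1 = _
  omega

/-- The norm `x ↦ x ^ (q ^ 4 + 1)` is `q ^ 4 + 1` to one onto the nonzero elements of the fixed
field of `x ↦ x ^ q ^ 4`. -/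
lemma card_norm_fibre [DecidableEq F] {z : F} (hz : z ≠ 0) (hz4 : z ^ q ^ 4 = z) :
    (Finset.univ.filter fun x : F => x ^ (q ^ 4 + 1) = z).card = q ^ 4 + 1 := by
  have hd1 : q ^ 4 - 1 ∣ q ^ 8 - 1 := by
    rw [pow_eight_sub_one_eq]
    exact Dvd.intro_left _ rfl
  have hd2 : q ^ 4 + 1 ∣ q ^ 8 - 1 := by
    rw [pow_eight_sub_one_eq]
    exact Dvd.intro _ rfl
  have hq4 : 0 < q ^ 4 + 1 := by positivity
  have hrange : (powMonoidHom (q ^ 4 + 1) : Fˣ →* Fˣ).range =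
      (powMonoidHom (q ^ 4 - 1) : Fˣ →* Fˣ).ker := by
    refine Subgroup.eq_of_le_of_card_ge ?_ (le_of_eq ?_)
    · rintro _ ⟨x, rfl⟩
      rw [MonoidHom.mem_ker, powMonoidHom_apply, powMonoidHom_apply, ← pow_mul,
        ← pow_eight_sub_one_eq, ← card_units_eq hF, pow_card_eq_one']
    · rw [card_ker_pow hF hd1, IsCyclic.card_powMonoidHom_range, card_units_eq hF,
        Nat.gcd_eq_right hd2, pow_eight_sub_one_eq, Nat.mul_div_cancel_left _ hq4]
  obtain ⟨x₀, hx₀⟩ : Units.mk0 z hz ∈ (powMonoidHom (q ^ 4 + 1) : Fˣ →* Fˣ).range := by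
    rw [hrange, ← frob_eq_self_iff_of_unit]
    exact hz4
  have hx₀' : (x₀ : F) ^ (q ^ 4 + 1) = z := by
    have := congrArg Units.val hx₀
    simpa using this
  rw [← Fintype.card_subtype, ← Nat.card_eq_fintype_card]
  refine Eq.trans (Eq.symm ?_) (card_ker_pow hF hd2)
  refine Nat.card_congr (Equiv.ofBijective
    (fun u => ⟨((u : Fˣ) : F) * x₀, ?_⟩) ⟨?_, ?_⟩)
  · have := congrArg Units.val (MonoidHom.mem_ker.1 u.2)
    simp only [powMonoidHom_apply, Units.val_pow_eq_pow_val, Units.val_one] at this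
    rw [mul_pow, this, hx₀', one_mul]
  · intro u v huv
    have := mul_right_cancel₀ x₀.ne_zero (Subtype.ext_iff.1 huv)
    exact Subtype.ext (Units.ext this)
  · rintro ⟨x, hx⟩
    have hx0 : x ≠ 0 := by
      rintro rfl
      rw [zero_pow hq4.ne'] at hx
      exact hz hx.symm
    refine ⟨⟨Units.mk0 x hx0 * x₀⁻¹, ?_⟩, ?_⟩
    · rw [MonoidHom.mem_ker, map_mul, map_inv, hx₀, mul_inv_eq_one]
      ext
      simpa using hx
    · simp

lemma sum_norm_eq {E : Type*} [Field E] [DecidableEq F] (f : F → E) :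
    ∑ x : F, f (x ^ (q ^ 4 + 1)) =
      f 0 + (q ^ 4 + 1) * ∑ z : F, if z ^ q ^ 4 = z ∧ z ≠ 0 then f z else 0 := by
  have h1 : ∑ x : F, f (x ^ (q ^ 4 + 1)) =
      ∑ z : F, ((Finset.univ.filter fun x : F => x ^ (q ^ 4 + 1) = z).card : E) * f z := by
    rw [← Finset.sum_fiberwise Finset.univ fun x : F => x ^ (q ^ 4 + 1)]
    refine Finset.sum_congr rfl fun z _ => ?_
    rw [Finset.sum_congr rfl (g := fun _ => f z), Finset.sum_const, nsmul_eq_mul]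
    intro x hx
    rw [(Finset.mem_filter.1 hx).2]
  have h2 : ∀ z : F, ((Finset.univ.filter fun x : F => x ^ (q ^ 4 + 1) = z).card : E) * f z =
      (if z = 0 then f 0 else 0) +
        ((q : E) ^ 4 + 1) * (if z ^ q ^ 4 = z ∧ z ≠ 0 then f z else 0) := by
    intro z
    by_cases hz : z = 0
    · subst hz
      have : (Finset.univ.filter fun x : F => x ^ (q ^ 4 + 1) = 0) = {0} := by
        ext x
        simp
      rw [this]
      simp
    · by_cases hz4 : z ^ q ^ 4 = z
      · rw [card_norm_fibre hF hz hz4]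
        simp [hz, hz4]
      · have : (Finset.univ.filter fun x : F => x ^ (q ^ 4 + 1) = z) = ∅ := by
          ext x
          simp only [Finset.mem_filter, Finset.mem_univ, true_and, Finset.notMem_empty, iff_false]
          rintro rfl
          refine hz4 ?_
          rw [pow_succ x, mul_pow, frob_frob, ← zero_add (4 + 4), frob_eight hF]
          simp [mul_comm]
        rw [this]
        simp [hz, hz4]
  rw [h1, Finset.sum_congr rfl fun z _ => h2 z, Finset.sum_add_distrib, ← Finset.mul_sum]
  simp

end Frobenius

/-- A character sum over a set that is invariant under translation by an element at which the
character is nontrivial. -/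
lemma sum_ite_addChar_eq_zero {G E : Type*} [AddCommGroup G] [Fintype G] [Field E]
    (θ : AddChar G E) (P : G → Prop) [DecidablePred P] (c₀ : G) (hP : ∀ c, P (c₀ + c) ↔ P c)
    (h : θ c₀ ≠ 1) : ∑ c, (if P c then θ c else 0) = 0 := by
  have h1 : ∑ c, (if P c then θ c else 0) = θ c₀ * ∑ c, (if P c then θ c else 0) := by
    refine (Equiv.sum_comp (Equiv.addLeft c₀) fun c => if P c then θ c else 0).symm.trans ?_
    rw [Finset.mul_sum]
    refine Finset.sum_congr rfl fun c _ => ?_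
    simp only [Equiv.coe_addLeft, hP, AddChar.map_add_eq_mul, mul_ite, mul_zero]
  by_contra hne
  exact h (mul_right_cancel₀ hne (by rw [← h1, one_mul]))

section TraceChar

variable {K F E : Type*} [Field K] [Fintype K] [Field F] [Fintype F] [Algebra K F] [Field E]

local notation "q" => Fintype.card K

/-- The additive character of `F` obtained from one of `K` by composing with the trace. -/
noncomputable def traceChar (F : Type*) [Field F] [Algebra K F] (ψ : AddChar K E) : AddChar F E :=
  ψ.compAddMonoidHom (Algebra.trace K F).toAddMonoidHom

omit [Fintype K] [Fintype F] in
lemma traceChar_apply (ψ : AddChar K E) (x : F) :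
    traceChar F ψ x = ψ (Algebra.trace K F x) := rfl

omit [Fintype K] [Fintype F] in
lemma traceChar_algebraMap_mul (ψ : AddChar K E) (c : K) (x : F) :
    traceChar F ψ (algebraMap K F c * x) = ψ (c * Algebra.trace K F x) := by
  rw [traceChar_apply, ← Algebra.smul_def, map_smul, smul_eq_mul]

variable {ψ : AddChar K E}

lemma traceChar_isPrimitive (hψ : ψ.IsPrimitive) : (traceChar F ψ).IsPrimitive := by
  refine AddChar.IsPrimitive.of_ne_one ?_
  obtain ⟨b, hb⟩ := AddChar.ne_one_iff.1 (by simpa using hψ one_ne_zero : ψ ≠ 1)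
  obtain ⟨a, ha⟩ := Algebra.trace_surjective K F b
  exact AddChar.ne_one_iff.2 ⟨a, by rwa [traceChar_apply, ha]⟩

lemma exists_traceChar_mul_ne_one (hψ : ψ.IsPrimitive) {a : F} (ha : a ≠ 0) :
    ∃ e, traceChar F ψ (a * e) ≠ 1 :=
  AddChar.ne_one_iff.1 (traceChar_isPrimitive hψ ha)

variable (hF : Module.finrank K F = 8) (h2 : (2 : F) ≠ 0) (hψ : ψ.IsPrimitive)
include hF h2 hψ

/-- The Gauss sum of the form `c * x ^ (q ^ 4 + 1)`. It does not depend on `c`, and its negative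
sign is that of an elliptic form. -/
lemma sum_traceChar_norm {c : F} (hc : c ≠ 0) (hc4 : c ^ q ^ 4 = c) :
    ∑ x : F, traceChar F ψ (c * x ^ (q ^ 4 + 1)) = -(q : E) ^ 4 := by
  classical
  rw [sum_norm_eq hF fun z => traceChar F ψ (c * z)]
  have h0 : ∑ z : F, (if z ^ q ^ 4 = z then (traceChar F ψ).mulShift c z else 0) = 0 := by
    obtain ⟨e, he⟩ := exists_traceChar_mul_ne_one (F := F) hψ (mul_ne_zero h2 hc)
    have hfix : (e + e ^ q ^ 4) ^ q ^ 4 = e + e ^ q ^ 4 := by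
      rw [frob_add, frob_frob, ← zero_add (4 + 4), frob_eight hF, add_comm]
      simp
    refine sum_ite_addChar_eq_zero _ _ (e + e ^ q ^ 4) (fun z => ?_) ?_
    · rw [frob_add, hfix, add_right_inj]
    · have : traceChar F ψ (c * e ^ q ^ 4) = traceChar F ψ (c * e) := by
        rw [traceChar_apply, traceChar_apply, mul_comm, trace_frob_mul hF (n := 4) rfl, hc4,
          mul_comm]
      rw [AddChar.mulShift_apply, mul_add, AddChar.map_add_eq_mul, this, ← AddChar.map_add_eq_mul,
        ← two_mul, ← mul_assoc]
      exact he
  have h1 : ∀ z : F, (if z ^ q ^ 4 = z ∧ z ≠ 0 then traceChar F ψ (c * z) else 0) =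
      (if z ^ q ^ 4 = z then (traceChar F ψ).mulShift c z else 0) - if z = 0 then 1 else 0 := by
    intro z
    by_cases hz : z = 0
    · simp [hz]
    · simp [hz, AddChar.mulShift_apply]
  simp only [h1, Finset.sum_sub_distrib, h0]
  simp

/-- The orthogonality relation over the fixed field of `c ↦ c ^ q ^ 2`. -/
lemma sum_fixed_traceChar [DecidableEq F] {z : F} (hz : z ^ q ^ 4 = z) :
    ∑ c : F, (if c ^ q ^ 2 = c then traceChar F ψ (c * z) else 0) =
      if z ^ q ^ 2 = -z then (q : E) ^ 2 else 0 := by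
  split_ifs with hz2
  · have h1 : ∀ c : F, (if c ^ q ^ 2 = c then traceChar F ψ (c * z) else 0) =
        if c ^ q ^ 2 = c then 1 else 0 := by
      intro c
      refine if_ctx_congr Iff.rfl (fun hc => ?_) fun _ => rfl
      -- `c * z` is mapped to its negative by a power of the Frobenius
      have ht := trace_frob (K := K) 2 (c * z)
      rw [mul_pow, hc, hz2, mul_neg, map_neg] at ht
      have h2K : (2 : K) ≠ 0 := fun h => h2 (by
        rw [← map_ofNat (algebraMap K F), h, map_zero])
      have ht0 : Algebra.trace K F (c * z) = 0 := by
        have : 2 * Algebra.trace K F (c * z) = 0 := by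
          linear_combination -ht
        exact (mul_eq_zero.1 this).resolve_left h2K
      rw [traceChar_apply, ht0, AddChar.map_zero_eq_one]
    simp only [h1]
    rw [← Finset.sum_filter, Finset.sum_const, card_fixed_two hF]
    simp
  · have hne : 2 * (z + z ^ q ^ 2) ≠ 0 :=
      mul_ne_zero h2 fun h => hz2 (eq_neg_of_add_eq_zero_right h)
    obtain ⟨e, he⟩ := exists_traceChar_mul_ne_one (F := F) hψ hne
    -- a trace of `e` to the fixed field, at which the character is nontrivial
    set s := e + e ^ q ^ 2 + e ^ q ^ 4 + e ^ q ^ 6 with hs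
    have hfix : s ^ q ^ 2 = s := by
      simp only [hs, frob_add, frob_frob]
      rw [show (6 + 2 : ℕ) = 0 + 8 from rfl, frob_eight hF]
      simp
      ring
    have h := sum_ite_addChar_eq_zero ((traceChar F ψ).mulShift z) (fun c => c ^ q ^ 2 = c) s
      (fun c => by rw [frob_add, hfix, add_right_inj]) (by
        rw [AddChar.mulShift_apply]
        have : Algebra.trace K F (z * s) = Algebra.trace K F (2 * (z + z ^ q ^ 2) * e) := by
          have e6 : z ^ q ^ 6 = z ^ q ^ 2 := by
            rw [show 6 = 4 + 2 from rfl, ← frob_frob, hz]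
          have t2 := trace_frob_mul hF (m := 2) (n := 6) rfl e z
          have t4 := trace_frob_mul hF (m := 4) (n := 4) rfl e z
          have t6 := trace_frob_mul hF (m := 6) (n := 2) rfl e z
          rw [e6] at t2
          rw [hz] at t4
          rw [mul_comm z s, hs, add_mul, add_mul, add_mul, map_add, map_add, map_add, t2, t4, t6,
            ← map_add, ← map_add, ← map_add]
          congr 1
          ring
        rw [traceChar_apply, this]
        exact he)
    simpa only [AddChar.mulShift_apply, mul_comm z] using h

omit hψ h2 in
lemma norm_frob_four (x : F) : (x ^ (q ^ 4 + 1)) ^ q ^ 4 = x ^ (q ^ 4 + 1) := by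
  rw [pow_succ x, mul_pow, frob_frob, ← zero_add (4 + 4), frob_eight hF]
  simp [mul_comm]

/-- The characters of `F`, indexed so that `w` corresponds to pairing with `w` under the polar form
of `x ↦ Tr (x ^ (q ^ 4 + 1))`. -/
noncomputable def polarChar (ψ : AddChar K E) (w : F) : AddChar F E :=
  (traceChar F ψ).mulShift (2 * w ^ q ^ 4)

omit [Fintype F] hF h2 hψ in
lemma polarChar_apply (w x : F) : polarChar ψ w x = traceChar F ψ (2 * w ^ q ^ 4 * x) := rfl

lemma polarChar_isOrthogonalFamily : IsOrthogonalFamily (polarChar (F := F) ψ) := by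
  classical
  have hprim := traceChar_isPrimitive (F := F) hψ
  refine ⟨fun x => ?_, fun x => ?_, fun w => ?_⟩
  · rw [polarChar_apply, frob_zero]
    simp
  · have h1 : ∀ w, polarChar ψ w x = traceChar F ψ (w * (2 * x ^ q ^ 4)) := by
      intro w
      rw [polarChar_apply, traceChar_apply, traceChar_apply,
        show 2 * w ^ q ^ 4 * x = w ^ q ^ 4 * (2 * x) by ring, trace_frob_mul hF (n := 4) rfl,
        mul_pow, ← map_ofNat (algebraMap K F), frob_algebraMap]
    have hx : 2 * x ^ q ^ 4 = 0 ↔ x = 0 := by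
      rw [mul_eq_zero_iff_left h2, pow_eq_zero_iff (pow_ne_zero _ Fintype.card_ne_zero)]
    simp only [h1, AddChar.sum_mulShift _ hprim, hx]
    split_ifs <;> simp
  · have hw : 2 * w ^ q ^ 4 = 0 ↔ w = 0 := by
      rw [mul_eq_zero_iff_left h2, pow_eq_zero_iff (pow_ne_zero _ Fintype.card_ne_zero)]
    simp only [polarChar_apply, mul_comm (2 * w ^ q ^ 4), AddChar.sum_mulShift _ hprim, hw]
    split_ifs <;> simp

/-- Completing the square in `sum_traceChar_norm`. -/
lemma sum_traceChar_norm_mul_polarChar {c : F} (hc : c ≠ 0) (hc4 : c ^ q ^ 4 = c) (w : F) :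
    ∑ x : F, traceChar F ψ (c * x ^ (q ^ 4 + 1)) * polarChar ψ w x =
      -(q : E) ^ 4 * traceChar F ψ (-c⁻¹ * w ^ (q ^ 4 + 1)) := by
  rw [← sum_traceChar_norm hF h2 hψ hc hc4, ← Equiv.sum_comp (Equiv.addRight (w / c)) fun x =>
    traceChar F ψ (c * x ^ (q ^ 4 + 1)), Finset.sum_mul]
  refine Finset.sum_congr rfl fun x _ => ?_
  rw [polarChar_apply, ← AddChar.map_add_eq_mul, ← AddChar.map_add_eq_mul]
  have h1 : Algebra.trace K F (w * x ^ q ^ 4) = Algebra.trace K F (w ^ q ^ 4 * x) :=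
    (trace_frob_mul hF (m := 4) (n := 4) rfl w x).symm
  have h3 : c * (Equiv.addRight (w / c) x) ^ (q ^ 4 + 1) + -c⁻¹ * w ^ (q ^ 4 + 1) =
      c * x ^ (q ^ 4 + 1) + w ^ q ^ 4 * x + w * x ^ q ^ 4 := by
    simp only [Equiv.coe_addRight, pow_succ _ (q ^ 4), frob_add, div_pow, hc4]
    field_simp
    ring
  rw [h3, traceChar_apply, traceChar_apply]
  congr 1
  rw [map_add, map_add, map_add, h1, mul_assoc, two_mul, map_add, add_assoc]

end TraceChar

/-! ### The spectra of the connection sets -/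

section Spectra

variable {K F E : Type*} [Field K] [Fintype K] [Field F] [Fintype F] [Algebra K F] [Field E]

local notation "q" => Fintype.card K

/-- The form `x ↦ Tr (x ^ (q ^ 4 + 1))` on `F`. -/
noncomputable def normTrace (K : Type*) {F : Type*} [Field K] [Fintype K] [Field F] [Algebra K F]
    (x : F) : K :=
  Algebra.trace K F (x ^ (Fintype.card K ^ 4 + 1))

/-- The nonzero `x` whose norm to the field of order `q ^ 4` has relative trace zero in the field
of order `q ^ 2`: the singular vectors of an elliptic form over the field of order `q ^ 2`. -/
def relSingular (K : Type*) {F : Type*} [Fintype K] [Field F] : Set F :=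
  {x | x ≠ 0 ∧ (x ^ (Fintype.card K ^ 4 + 1)) ^ Fintype.card K ^ 2 =
    -x ^ (Fintype.card K ^ 4 + 1)}

open scoped Classical in
/-- The vectors at which the form `x ↦ Tr (x ^ (q ^ 4 + 1))`, multiplied by `a`, takes values
with quadratic character `s`. -/
noncomputable def normTraceClass (K : Type*) {F : Type*} [Field K] [Fintype K] [Field F]
    [Algebra K F] (a : K) (s : ℤ) : Set F :=
  {x | quadraticChar K (a * normTrace K x) = s}

lemma sum_neg_inv {G M : Type*} [Field G] [Fintype G] [AddCommMonoid M] (f : G → M) :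
    ∑ c, f (-c⁻¹) = ∑ c, f c :=
  Equiv.sum_comp ((Equiv.inv G).trans (Equiv.neg G)) f

omit [Fintype F] in
lemma normTrace_zero : normTrace K (0 : F) = 0 := by
  simp [normTrace]

lemma quadraticChar_ringHomComp_ne_one {K E : Type*} [Field K] [Fintype K] [DecidableEq K]
    [Field E] [CharZero E] (hK : ringChar K ≠ 2) :
    (quadraticChar K).ringHomComp (Int.castRingHom E) ≠ 1 := by
  obtain ⟨a, ha⟩ := quadraticChar_exists_neg_one' hK
  intro h
  have h1 : (quadraticChar K).ringHomComp (Int.castRingHom E) a = (quadraticChar K a : E) := rfl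
  rw [h, ha, MulChar.one_apply_coe] at h1
  norm_num at h1

omit [Fintype F] in
lemma mem_normTraceClass [DecidableEq K] {a : K} {s : ℤ} {x : F} :
    x ∈ normTraceClass K a s ↔ quadraticChar K (a * normTrace K x) = s := by
  rw [normTraceClass, Set.mem_ofPred_eq]
  convert Iff.rfl

lemma normTrace_eq_zero_of_mem_relSingular (h2 : (2 : F) ≠ 0) {x : F} (hx : x ∈ relSingular K) :
    normTrace K x = 0 := by
  have h := trace_frob (K := K) 2 (x ^ (q ^ 4 + 1))
  rw [hx.2, map_neg] at h
  have h2K : (2 : K) ≠ 0 := fun h => h2 (by rw [← map_ofNat (algebraMap K F), h, map_zero])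
  have : 2 * normTrace K x = 0 := by
    rw [normTrace]
    linear_combination -h
  exact (mul_eq_zero.1 this).resolve_left h2K

variable {ψ : AddChar K E}
variable (hF : Module.finrank K F = 8) (h2 : (2 : F) ≠ 0) (hψ : ψ.IsPrimitive)
include hF h2 hψ

/-- The Fourier transform of a sum over parameters `c` of the functions `Ψ (c N x)`, when the set
`P` of parameters contains `0` and is stable under `c ↦ -c⁻¹`. For `c ≠ 0` the transform of
`Ψ (c N x)` is known by `sum_traceChar_norm_mul_polarChar`, and `c ↦ -c⁻¹` permutes these terms. -/
lemma sum_fixed_mul_polarChar [DecidableEq F] (P : F → Prop) [DecidablePred P] (hP0 : P 0)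
    (hP : ∀ c, P (-c⁻¹) ↔ P c) (hP4 : ∀ c, P c → c ^ q ^ 4 = c) (w : F) :
    ∑ x, (∑ c, if P c then traceChar F ψ (c * x ^ (q ^ 4 + 1)) else 0) * polarChar ψ w x =
      (if w = 0 then (q : E) ^ 8 else 0) + (q : E) ^ 4 -
        (q : E) ^ 4 * ∑ c, if P c then traceChar F ψ (c * w ^ (q ^ 4 + 1)) else 0 := by
  have hcard : (Fintype.card F : E) = (q : E) ^ 8 := by
    rw [card_eq_pow_eight hF]
    push_cast
    rfl
  have h0 := (polarChar_isOrthogonalFamily hF h2 hψ).sum_group w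
  have h1 : ∀ c : F, ∑ x, (if P c then traceChar F ψ (c * x ^ (q ^ 4 + 1)) else 0) *
      polarChar ψ w x = (if c = 0 then (if w = 0 then (q : E) ^ 8 else 0) + (q : E) ^ 4 else 0) -
        (q : E) ^ 4 * (if P (-c⁻¹) then traceChar F ψ (-c⁻¹ * w ^ (q ^ 4 + 1)) else 0) := by
    intro c
    rw [if_congr (hP c) rfl rfl]
    by_cases hc : c = 0
    · subst hc
      simp [hP0, h0, hcard]
    · by_cases hPc : P c
      · simp only [hPc, hc, if_true, if_false, zero_sub,
          sum_traceChar_norm_mul_polarChar hF h2 hψ hc (hP4 c hPc) w, neg_mul]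
      · simp [hPc, hc]
  simp only [Finset.sum_mul]
  rw [Finset.sum_comm, Finset.sum_congr rfl fun c _ => h1 c, Finset.sum_sub_distrib,
    ← Finset.mul_sum, sum_neg_inv fun c => if P c then traceChar F ψ (c * w ^ (q ^ 4 + 1)) else 0]
  simp

variable [CharZero E]

theorem relSingular_spectrum :
    HasNegLatinSpectrum (polarChar (F := F) ψ) (relSingular K) (relSingular K) (q ^ 4)
      (q ^ 2 - 1) := by
  classical
  refine ⟨fun h => h.1 rfl, fun w => ?_⟩
  have hq : (q : E) ≠ 0 := Nat.cast_ne_zero.2 Fintype.card_ne_zero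
  have hmem : ∀ x : F, (x ^ (q ^ 4 + 1)) ^ q ^ 2 = -x ^ (q ^ 4 + 1) ↔
      x ∈ relSingular K ∨ x = 0 := by
    intro x
    by_cases hx : x = 0
    · subst hx
      simp
    · simp [relSingular, hx]
  have key := sum_fixed_mul_polarChar hF h2 hψ (fun c => c ^ q ^ 2 = c) (frob_zero 2)
    (fun c => by rw [frob_neg, inv_pow, neg_inj, inv_inj])
    (fun c hc => by rw [show 4 = 2 + 2 from rfl, ← frob_frob, hc, hc]) w
  simp only [sum_fixed_traceChar hF h2 hψ (norm_frob_four hF _), hmem] at key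
  have hs : ∑ x : F, (if x ∈ relSingular K ∨ x = 0 then (q : E) ^ 2 else 0) * polarChar ψ w x =
      (q : E) ^ 2 * (charSum (polarChar ψ w) (relSingular K) + 1) := by
    have h1 : ∑ x : F, (if x = 0 then polarChar ψ w x else 0) = 1 := by simp
    rw [charSum, ← h1, ← Finset.sum_add_distrib, Finset.mul_sum]
    refine Finset.sum_congr rfl fun x _ => ?_
    by_cases hx : x = 0
    · simp [hx, relSingular]
    · by_cases hx' : x ∈ relSingular K <;> simp [hx, hx']
  rw [hs] at key
  have h1q : 1 ≤ q ^ 2 := Nat.one_le_pow _ _ Fintype.card_pos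
  apply mul_left_cancel₀ (pow_ne_zero 2 hq)
  push_cast [Nat.cast_sub h1q]
  by_cases hw0 : w = 0
  · have hw : (0 : F) ∉ relSingular K := fun h => h.1 rfl
    subst hw0
    simp only [or_true, if_true, hw, if_false] at key ⊢
    linear_combination key
  · by_cases hw : w ∈ relSingular K
    · simp only [hw0, hw, or_false, if_true, if_false] at key ⊢
      linear_combination key
    · simp only [hw0, hw, or_false, if_false] at key ⊢
      linear_combination key

/-- The character sum of the zero set of `normTrace`. -/
lemma sum_normTrace_eq_zero [DecidableEq K] [DecidableEq F] (w : F) :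
    ∑ x, (if normTrace K x = 0 then polarChar ψ w x else 0) =
      (if w = 0 then (q : E) ^ 7 else 0) + (q : E) ^ 3 -
        if normTrace K w = 0 then (q : E) ^ 4 else 0 := by
  have hq : (q : E) ≠ 0 := Nat.cast_ne_zero.2 Fintype.card_ne_zero
  -- sums over `K`, as sums over its image in `F`
  have himg : ∀ x : F, ∑ c, (if c ∈ Set.range (algebraMap K F) then
      traceChar F ψ (c * x ^ (q ^ 4 + 1)) else 0) = if normTrace K x = 0 then (q : E) else 0 := by
    classical
    intro x
    have h1 : ∑ c : K, ψ (c * normTrace K x) = if normTrace K x = 0 then (q : E) else 0 := by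
      rw [AddChar.sum_mulShift _ hψ]
      split_ifs <;> simp
    rw [← h1, ← Finset.sum_filter]
    symm
    refine Finset.sum_bij (fun c _ => algebraMap K F c) ?_ ?_ ?_ ?_
    · simp
    · intro a _ b _ hab
      exact (algebraMap K F).injective hab
    · intro b hb
      obtain ⟨c, hc⟩ := (Finset.mem_filter.1 hb).2
      exact ⟨c, Finset.mem_univ _, hc⟩
    · intro c _
      rw [traceChar_algebraMap_mul, normTrace]
  have key := sum_fixed_mul_polarChar hF h2 hψ (fun c => c ∈ Set.range (algebraMap K F))
    ⟨0, map_zero _⟩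
    (fun c => ⟨fun ⟨d, hd⟩ => ⟨-d⁻¹, by simp [hd]⟩, fun ⟨d, hd⟩ => ⟨-d⁻¹, by simp [hd]⟩⟩)
    (fun c ⟨d, hd⟩ => by rw [← hd, frob_algebraMap]) w
  simp only [himg] at key
  have hs : ∑ x : F, (if normTrace K x = 0 then (q : E) else 0) * polarChar ψ w x =
      q * ∑ x, (if normTrace K x = 0 then polarChar ψ w x else 0) := by
    rw [Finset.mul_sum]
    refine Finset.sum_congr rfl fun x _ => ?_
    split_ifs <;> simp
  rw [hs] at key
  apply mul_left_cancel₀ hq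
  rw [key]
  split_ifs <;> ring

/-- The function `x ↦ η (Tr (x ^ (q ^ 4 + 1)))`, with `η` the quadratic character, is up to
scaling and a change of sign of the argument its own Fourier transform. -/
lemma sum_quadraticChar_normTrace [DecidableEq K] (hK : ringChar K ≠ 2) (w : F) :
    ∑ x, (quadraticChar K (normTrace K x) : E) * polarChar ψ w x =
      -(q : E) ^ 4 * (quadraticChar K (-1 * normTrace K w) : E) := by
  set η : MulChar K E := (quadraticChar K).ringHomComp (Int.castRingHom E)
  have hη1 : ∀ t, η t = (quadraticChar K t : E) := fun t => rfl
  have hne : η ≠ 1 := quadraticChar_ringHomComp_ne_one hK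
  have hg : gaussSum η ψ ≠ 0 :=
    gaussSum_ne_zero_of_nontrivial (Nat.cast_ne_zero.2 Fintype.card_ne_zero) hne hψ
  have hinv : ∀ c, η c⁻¹ = η c := by
    intro c
    by_cases hc : c = 0
    · simp [hc]
    · rw [hη1, hη1]
      congr 1
      have h1 : quadraticChar K c⁻¹ * quadraticChar K c = 1 := by
        rw [← map_mul, inv_mul_cancel₀ hc, map_one]
      rcases quadraticChar_dichotomy hc with h | h <;> rw [h] at h1 ⊢ <;> linarith
  -- the Gauss sum expresses the quadratic character by additive characters
  have hgt : ∀ t, gaussSum η ψ * η t = ∑ c, η c * ψ (c * t) := by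
    intro t
    by_cases ht : t = 0
    · subst ht
      rw [MulChar.map_zero, mul_zero]
      simp [MulChar.sum_eq_zero_of_ne_one hne]
    · have h1 := gaussSum_mulShift η ψ (Units.mk0 t ht)
      rw [Units.val_mk0] at h1
      have h2 : η t * η t = 1 := by
        nth_rw 1 [← hinv t]
        rw [← map_mul, inv_mul_cancel₀ ht, map_one]
      calc gaussSum η ψ * η t = gaussSum η (ψ.mulShift t) := by
            rw [← h1, mul_comm, ← mul_assoc, h2, one_mul]
        _ = _ := by simp [gaussSum, AddChar.mulShift_apply, mul_comm]
  apply mul_left_cancel₀ hg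
  have hterm : ∀ c : K, ∑ x : F, η c * ψ (c * normTrace K x) * polarChar ψ w x =
      -(q : E) ^ 4 * (η (-1) * (η (-c⁻¹) * ψ (-c⁻¹ * normTrace K w))) := by
    intro c
    by_cases hc : c = 0
    · simp [hc, MulChar.map_zero]
    · have h1 := sum_traceChar_norm_mul_polarChar hF h2 hψ (c := algebraMap K F c)
        (by simpa using hc) (frob_algebraMap 4 c) w
      rw [← map_inv₀, ← map_neg, traceChar_algebraMap_mul] at h1
      simp only [traceChar_algebraMap_mul] at h1
      simp only [mul_assoc, ← Finset.mul_sum]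
      rw [normTrace, ← mul_assoc (η (-1)), ← map_mul, neg_one_mul, neg_neg, hinv]
      simp only [normTrace]
      rw [h1]
      ring
  calc gaussSum η ψ * ∑ x, (quadraticChar K (normTrace K x) : E) * polarChar ψ w x
      = ∑ c : K, ∑ x : F, η c * ψ (c * normTrace K x) * polarChar ψ w x := by
        rw [Finset.sum_comm, Finset.mul_sum]
        refine Finset.sum_congr rfl fun x _ => ?_
        rw [← hη1, ← mul_assoc, hgt, Finset.sum_mul]
    _ = -(q : E) ^ 4 * (η (-1) * ∑ c, η c * ψ (c * normTrace K w)) := by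
        rw [Finset.sum_congr rfl fun c _ => hterm c, ← Finset.mul_sum, ← Finset.mul_sum,
          sum_neg_inv fun c => η c * ψ (c * normTrace K w)]
    _ = _ := by
        rw [← hgt, ← hη1, map_mul]
        ring

theorem normTraceClass_spectrum (hK : ringChar K ≠ 2) {s : ℤ} (hs : s = 1 ∨ s = -1) :
    HasNegLatinSpectrum (polarChar (F := F) ψ) (normTraceClass K 1 s) (normTraceClass K (-1) s)
      (q ^ 4) (q ^ 3 * ((q - 1) / 2)) := by
  classical
  have hs0 : s ≠ 0 := by rcases hs with rfl | rfl <;> norm_num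
  have hss : s * s = 1 := by rcases hs with rfl | rfl <;> norm_num
  refine ⟨?_, fun w => ?_⟩
  · rw [mem_normTraceClass, normTrace_zero, mul_zero, MulChar.map_zero]
    exact hs0.symm
  have hr : (((q ^ 3 * ((q - 1) / 2) : ℕ)) : E) * 2 = (q : E) ^ 3 * (q - 1) := by
    have hodd : q % 2 = 1 := FiniteField.odd_card_of_char_ne_two hK
    have h1 : (q - 1) / 2 * 2 + 1 = q := by omega
    have h2 : ((((q - 1) / 2 : ℕ)) : E) * 2 + 1 = q := by exact_mod_cast h1
    push_cast
    linear_combination (q : E) ^ 3 * h2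
  have hind : ∀ (a : K), a ≠ 0 → ∀ x : F, (if x ∈ normTraceClass K a s then (1 : E) else 0) * 2 =
      1 - (if normTrace K x = 0 then 1 else 0) + s * (quadraticChar K (a * normTrace K x) : E) := by
    intro a ha x
    by_cases hx : normTrace K x = 0
    · simp [mem_normTraceClass, hx, hs0.symm]
    · simp only [mem_normTraceClass, hx, if_false]
      rcases quadraticChar_dichotomy (mul_ne_zero ha hx) with h | h <;> rw [h] <;>
        rcases hs with rfl | rfl <;> norm_num
  have hsum : charSum (polarChar ψ w) (normTraceClass K 1 s) * 2 =
      ∑ x : F, polarChar ψ w x - ∑ x, (if normTrace K x = 0 then polarChar ψ w x else 0) +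
        s * ∑ x, (quadraticChar K (normTrace K x) : E) * polarChar ψ w x := by
    rw [charSum, Finset.sum_mul, Finset.mul_sum, ← Finset.sum_sub_distrib,
      ← Finset.sum_add_distrib]
    refine Finset.sum_congr rfl fun x _ => ?_
    have h1 := hind 1 one_ne_zero x
    rw [one_mul] at h1
    calc _ = (if x ∈ normTraceClass K 1 s then (1 : E) else 0) * 2 * polarChar ψ w x := by
          split_ifs <;> ring
      _ = _ := by
          rw [h1]
          split_ifs <;> ring
  have hcard : (Fintype.card F : E) = (q : E) ^ 8 := by
    rw [card_eq_pow_eight hF]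
    push_cast
    rfl
  have h0 := (polarChar_isOrthogonalFamily hF h2 hψ).sum_group w
  have h1 := hind (-1) (neg_ne_zero.2 one_ne_zero) w
  rw [h0, hcard, sum_normTrace_eq_zero hF h2 hψ, sum_quadraticChar_normTrace hF h2 hψ hK] at hsum
  apply mul_right_cancel₀ (two_ne_zero (α := E))
  rw [hsum]
  by_cases hw0 : w = 0
  · subst hw0
    simp only [normTrace_zero, if_true, mul_zero, MulChar.map_zero, Int.cast_zero] at h1 ⊢
    rw [if_neg (by
      rw [mem_normTraceClass, normTrace_zero, mul_zero, MulChar.map_zero]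
      exact hs0.symm)]
    push_cast at hr ⊢
    linear_combination (-1 - (q : E) ^ 4) * hr
  · simp only [hw0, if_false] at h1 ⊢
    have e1 : (if w ∈ normTraceClass K (-1) s then ((q ^ 4 : ℕ) : E) else 0) =
        (q : E) ^ 4 * if w ∈ normTraceClass K (-1) s then (1 : E) else 0 := by
      split_ifs <;> simp
    have e2 : (if normTrace K w = 0 then (q : E) ^ 4 else 0) =
        (q : E) ^ 4 * if normTrace K w = 0 then (1 : E) else 0 := by
      split_ifs <;> simp
    rw [e1, e2]
    linear_combination (q : E) ^ 4 * h1 - hr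

end Spectra

/-! ### The cyclotomic class -/

section Cyclotomic

variable {K F : Type*} [Field K] [Fintype K] [Field F] [Fintype F] [Algebra K F]

local notation "q" => Fintype.card K

/-- With `N = q ^ 2 + 1`, the power `γ ^ ((q ^ 8 - 1) / N)` has order `N`, so its `m`-th power
is `-1` exactly when `m` is `N / 2` modulo `N`. -/
theorem cyclotomicClass_eq_relSingular (hF : Module.finrank K F = 8)
    (hodd : Odd q) (γ : Fˣ) (hγ : ∀ y : Fˣ, y ∈ Subgroup.zpowers γ) :
    cyclotomicClass γ (q ^ 2 + 1) ((q ^ 2 + 1) / 2) = relSingular K := by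
  have hq2 : Odd (q ^ 2) := hodd.pow
  have hq3 : 1 < q := Fintype.one_lt_card
  have hq2' : 1 < q ^ 2 := Nat.one_lt_pow two_ne_zero hq3
  set N := q ^ 2 + 1 with hN
  have hNeven : N / 2 * 2 = N := Nat.div_mul_cancel hq2.add_one.two_dvd
  set t := (q ^ 4 + 1) * (q ^ 2 - 1) with ht
  have htN : q ^ 8 - 1 = t * N := by
    rw [pow_eight_sub_one_eq, pow_four_sub_one_eq]
    ring
  have ht0 : t ≠ 0 := Nat.mul_ne_zero (by omega) (by omega)
  have hγo : orderOf γ = q ^ 8 - 1 := by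
    rw [orderOf_eq_card_of_forall_mem_zpowers hγ, card_units_eq hF]
  have hδ : orderOf (γ ^ t) = N := by
    rw [orderOf_pow_of_dvd ht0 (by rw [hγo, htN]; exact Dvd.intro _ rfl), hγo, htN,
      Nat.mul_div_cancel_left _ (Nat.pos_of_ne_zero ht0)]
  have hneg : (γ ^ t) ^ (N / 2) = -1 := by
    have h1 : ((γ ^ t) ^ (N / 2)) ^ 2 = 1 := by
      rw [← pow_mul, hNeven, ← hδ, pow_orderOf_eq_one]
    have h3 : (((γ ^ t) ^ (N / 2) : Fˣ) : F) = 1 ∨ (((γ ^ t) ^ (N / 2) : Fˣ) : F) = -1 := by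
      rw [← mul_self_eq_one_iff, ← sq, ← Units.val_pow_eq_pow_val, h1, Units.val_one]
    refine h3.elim (fun h => ?_) fun h => Units.ext h
    rw [Units.val_eq_one] at h
    have := Nat.le_of_dvd (by omega) (orderOf_dvd_of_pow_eq_one h)
    omega
  have key : ∀ m : ℕ, ((γ ^ m : Fˣ) : F) ∈ relSingular K ↔ m % N = N / 2 := by
    intro m
    have e1 : q ^ 2 = (q ^ 2 - 1) + 1 := by omega
    have h3 : (((γ ^ m : Fˣ) : F) ^ (q ^ 4 + 1)) ^ q ^ 2 = -((γ ^ m : Fˣ) : F) ^ (q ^ 4 + 1) ↔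
        (γ ^ t) ^ m = -1 := by
      conv_lhs => rw [e1, pow_succ _ (q ^ 2 - 1), neg_eq_neg_one_mul]
      rw [mul_left_inj' (pow_ne_zero _ (Units.ne_zero _)), ← pow_mul (γ : Fˣ), mul_comm t m,
        pow_mul (γ : Fˣ), ← Units.val_inj, ← pow_mul, ← ht]
      simp
    rw [relSingular, Set.mem_ofPred_eq, h3, ← hneg, pow_eq_pow_iff_modEq, hδ]
    simp only [ne_eq, Units.ne_zero, not_false_eq_true, true_and, Nat.ModEq]
    rw [Nat.mod_eq_of_lt (show N / 2 < N by omega)]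
  classical
  ext x
  constructor
  · rintro ⟨j, -, rfl⟩
    rw [← Units.val_pow_eq_pow_val, key, Nat.mul_add_mod_self_right, Nat.mod_eq_of_lt (by omega)]
  · intro hx
    obtain ⟨m, hm, hmx⟩ : ∃ m < q ^ 8 - 1, γ ^ m = Units.mk0 x hx.1 := by
      rw [← hγo]
      have := hγ (Units.mk0 x hx.1)
      rw [mem_zpowers_iff_mem_range_orderOf, Finset.mem_image] at this
      obtain ⟨m, hm, h⟩ := this
      exact ⟨m, Finset.mem_range.1 hm, h⟩
    have hmx' : ((γ ^ m : Fˣ) : F) = x := by rw [hmx, Units.val_mk0]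
    refine ⟨m / N, ?_, ?_⟩
    · rw [Nat.card_eq_fintype_card, card_eq_pow_eight hF]
      exact Nat.div_lt_div_of_lt_of_dvd (by rw [htN]; exact Dvd.intro_left _ rfl) hm
    · rw [← hmx', key] at hx
      rw [← hmx', Units.val_pow_eq_pow_val, ← hx, mul_comm, Nat.div_add_mod]

end Cyclotomic

/-! ### Classification of elliptic forms in dimension eight -/

section Classification

variable {K : Type*} [Field K]

open QuadraticMap

lemma equivalent_cons {n : ℕ} (a : K) {w w' : Fin n → K}
    (h : Equivalent (weightedSumSquares K w) (weightedSumSquares K w')) :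
    Equivalent (weightedSumSquares K (Fin.cons a w : Fin (n + 1) → K))
      (weightedSumSquares K (Fin.cons a w' : Fin (n + 1) → K)) := by
  obtain ⟨e⟩ := h
  refine ⟨⟨(Fin.consLinearEquiv K fun _ => K).symm ≪≫ₗ
    ((LinearEquiv.refl K K).prodCongr e.toLinearEquiv) ≪≫ₗ (Fin.consLinearEquiv K fun _ => K),
    fun x => ?_⟩⟩
  have := e.map_app (Fin.tail x)
  simp only [weightedSumSquares_apply] at this ⊢
  rw [Fin.sum_univ_succ, Fin.sum_univ_succ]
  simpa [Fin.tail] using this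

/-- If `a s ^ 2 + b t ^ 2 = 1`, then `(s, t)` and `(-b t, a s)` are orthogonal for the form
`a x ^ 2 + b y ^ 2`, with values `1` and `a b`. -/
lemma equivalent_cons_cons {n : ℕ} {a b s t : K} (h : a * s ^ 2 + b * t ^ 2 = 1) (v : Fin n → K) :
    Equivalent
      (weightedSumSquares K (Fin.cons a (Fin.cons b v : Fin (n + 1) → K) : Fin (n + 2) → K))
      (weightedSumSquares K
        (Fin.cons (a * b) (Fin.cons 1 v : Fin (n + 1) → K) : Fin (n + 2) → K)) := by
  refine ⟨⟨{
    toFun := fun x => Fin.cons (-t * x 0 + s * x 1)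
      (Fin.cons (a * s * x 0 + b * t * x 1) fun i => x i.succ.succ : Fin (n + 1) → K)
    invFun := fun y => Fin.cons (-b * t * y 0 + s * y 1)
      (Fin.cons (a * s * y 0 + t * y 1) fun i => y i.succ.succ : Fin (n + 1) → K)
    map_add' := fun x y => ?_
    map_smul' := fun c x => ?_
    left_inv := fun x => ?_
    right_inv := fun x => ?_ }, fun x => ?_⟩⟩
  · ext i
    refine Fin.cases ?_ (fun i => Fin.cases ?_ (fun i => ?_) i) i <;> simp <;> ring
  · ext i
    refine Fin.cases ?_ (fun i => Fin.cases ?_ (fun i => ?_) i) i <;> simp <;> ring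
  · ext i
    refine Fin.cases ?_ (fun i => Fin.cases ?_ (fun i => ?_) i) i
    · simp [Fin.cons_one]
      linear_combination x 0 * h
    · simp [Fin.cons_one]
      linear_combination x 1 * h
    · simp
  · ext i
    refine Fin.cases ?_ (fun i => Fin.cases ?_ (fun i => ?_) i) i
    · simp [Fin.cons_one]
      linear_combination x 0 * h
    · simp [Fin.cons_one]
      linear_combination x 1 * h
    · simp
  · simp only [weightedSumSquares_apply, Fin.sum_univ_succ]
    simp
    linear_combination (a * x 0 ^ 2 + b * x 1 ^ 2) * h

lemma equivalent_cons_of_isSquare {n : ℕ} {d d' c : K} (hc : c ≠ 0) (h : d' * c ^ 2 = d)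
    (v : Fin n → K) :
    Equivalent (weightedSumSquares K (Fin.cons d v : Fin (n + 1) → K))
      (weightedSumSquares K (Fin.cons d' v : Fin (n + 1) → K)) := by
  refine ⟨QuadraticForm.isometryEquivWeightedSumSquaresWeightedSumSquares
    (Fin.cons (Units.mk0 c hc) fun _ => 1 : Fin (n + 1) → Kˣ) fun i => ?_⟩
  refine Fin.cases ?_ (fun i => ?_) i
  · simpa using h
  · simp

variable [Fintype K]

open Polynomial in
lemma exists_mul_sq_add_mul_sq (hK : ringChar K ≠ 2) {a b : K} (ha : a ≠ 0) (hb : b ≠ 0) (c : K) :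
    ∃ s t : K, a * s ^ 2 + b * t ^ 2 = c := by
  have hdeg : degree (C c) < degree (C b * X ^ 2) := by
    rw [degree_C_mul_X_pow _ hb]
    exact degree_C_le.trans_lt (by norm_num)
  obtain ⟨s, t, h⟩ := FiniteField.exists_root_sum_quadratic
    (f := C a * X ^ 2) (g := C b * X ^ 2 - C c) (degree_C_mul_X_pow _ ha)
    (by rw [degree_sub_eq_left_of_degree_lt hdeg, degree_C_mul_X_pow _ hb]; rfl)
    (FiniteField.odd_card_of_char_ne_two hK)
  simp only [eval_mul, eval_C, eval_pow, eval_X, eval_sub] at h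
  exact ⟨s, t, by linear_combination h⟩

/-- Over a finite field of odd characteristic a nondegenerate diagonal form is equivalent to one
with all coefficients but the first equal to `1`, so it is determined by its discriminant. -/
lemma exists_equivalent_cons_one (hK : ringChar K ≠ 2) {n : ℕ} (w : Fin (n + 1) → K)
    (hw : ∀ i, w i ≠ 0) : ∃ d : K, d ≠ 0 ∧
      Equivalent (weightedSumSquares K w)
        (weightedSumSquares K (Fin.cons d fun _ => 1 : Fin (n + 1) → K)) := by
  induction n with
  | zero =>
    refine ⟨w 0, hw 0, ?_⟩
    have : w = (Fin.cons (w 0) fun _ => 1 : Fin 1 → K) := by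
      ext i
      rw [Fin.fin_one_eq_zero i, Fin.cons_zero]
    rw [← this]
  | succ n ih =>
    obtain ⟨d, hd, h⟩ := ih (Fin.tail w) fun i => hw i.succ
    have hw0 := hw 0
    obtain ⟨s, t, hst⟩ : ∃ s t : K, w 0 * s ^ 2 + d * t ^ 2 = 1 :=
      exists_mul_sq_add_mul_sq hK hw0 hd 1
    refine ⟨w 0 * d, mul_ne_zero hw0 hd, ?_⟩
    have h1 := equivalent_cons (w 0) h
    rw [Fin.cons_self_tail] at h1
    have h2 := h1.trans (equivalent_cons_cons hst fun _ => 1)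
    have h3 : (Fin.cons 1 fun _ => 1 : Fin (n + 1) → K) = fun _ => 1 := by
      ext i
      refine Fin.cases ?_ (fun i => ?_) i <;> simp
    rwa [h3] at h2

/-- A sum of eight squares over a finite field is hyperbolic: with `a ^ 2 + b ^ 2 = -1`, the form
in four variables vanishes at `(s, t, a s + b t, a t - b s)`. -/
lemma exists_totallySingular_of_sum_squares (hK : ringChar K ≠ 2) {V : Type*} [AddCommGroup V]
    [Module K V] (Q : QuadraticForm K V)
    (h : Equivalent Q (weightedSumSquares K fun _ : Fin 8 => (1 : K))) :
    ∃ W : Submodule K V, (∀ x ∈ W, Q x = 0) ∧ Module.finrank K W = 4 := by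
  obtain ⟨a, b, hab⟩ : ∃ a b : K, a ^ 2 + b ^ 2 = -1 := by
    simpa using exists_mul_sq_add_mul_sq hK (one_ne_zero (α := K)) one_ne_zero (-1)
  obtain ⟨e⟩ := h
  let f : (Fin 4 → K) →ₗ[K] (Fin 8 → K) :=
    { toFun := fun x => ![x 0, x 1, a * x 0 + b * x 1, a * x 1 - b * x 0,
        x 2, x 3, a * x 2 + b * x 3, a * x 3 - b * x 2]
      map_add' := fun x y => by
        ext i
        fin_cases i <;> simp <;> ring
      map_smul' := fun c x => by
        ext i
        fin_cases i <;> simp <;> ring }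
  have hf : Function.Injective f := by
    intro x y hxy
    have h := fun i => congrFun hxy i
    ext i
    fin_cases i
    · exact h 0
    · exact h 1
    · exact h 4
    · exact h 5
  let g := e.symm.toLinearEquiv.toLinearMap ∘ₗ f
  have hg : Function.Injective g := e.symm.toLinearEquiv.injective.comp hf
  refine ⟨LinearMap.range g, ?_, ?_⟩
  · rintro _ ⟨x, rfl⟩
    have : Q (g x) = weightedSumSquares K (fun _ : Fin 8 => (1 : K)) (f x) := e.symm.map_app (f x)
    rw [this, weightedSumSquares_apply, Fin.sum_univ_eight]
    simp [f]
    linear_combination (x 0 ^ 2 + x 1 ^ 2 + x 2 ^ 2 + x 3 ^ 2) * hab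
  · rw [LinearMap.finrank_range_of_inj hg]
    simp

/-- The Gauss sum of a sum of eight squares is positive. -/
lemma sum_addChar_sum_squares (hK : ringChar K ≠ 2) {E : Type*} [Field E] [CharZero E]
    {ψ : AddChar K E} (hψ : ψ.IsPrimitive) :
    ∑ x : Fin 8 → K, ψ (weightedSumSquares K (fun _ => (1 : K)) x) = (Fintype.card K : E) ^ 4 := by
  classical
  set η : MulChar K E := (quadraticChar K).ringHomComp (Int.castRingHom E)
  have hη1 : ∀ t, η t = (quadraticChar K t : E) := fun t => rfl
  have hne : η ≠ 1 := quadraticChar_ringHomComp_ne_one hK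
  have hquad : η.IsQuadratic := (quadraticChar_isQuadratic K).comp _
  have h1 : ∑ t : K, ψ (t ^ 2) = gaussSum η ψ := by
    have h2 : ∑ t : K, ψ (t ^ 2) = ∑ y : K, (η y + 1) * ψ y := by
      rw [← Finset.sum_fiberwise Finset.univ fun t : K => t ^ 2]
      refine Finset.sum_congr rfl fun y _ => ?_
      rw [Finset.sum_congr rfl (g := fun _ => ψ y), Finset.sum_const, nsmul_eq_mul]
      · congr 1
        have := quadraticChar_card_sqrts hK y
        rw [hη1]
        rw [← Int.cast_one, ← Int.cast_add, ← this, Int.cast_natCast]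
        congr 2
        ext t
        simp
      · intro x hx
        rw [(Finset.mem_filter.1 hx).2]
    have h3 : ∑ y, ψ y = 0 := AddChar.sum_eq_zero_of_ne_one (by simpa using hψ one_ne_zero)
    rw [h2]
    simp only [add_mul, one_mul, Finset.sum_add_distrib, h3, add_zero]
    rfl
  have h2 : ∑ x : Fin 8 → K, ψ (weightedSumSquares K (fun _ => (1 : K)) x) =
      (∑ t : K, ψ (t ^ 2)) ^ 8 := by
    rw [Fintype.sum_pow]
    refine Finset.sum_congr rfl fun x _ => ?_
    rw [weightedSumSquares_apply, Fin.sum_univ_eight, Fin.prod_univ_eight]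
    simp [pow_two, AddChar.map_add_eq_mul]
  have h3 : η (-1) ^ 2 = 1 := by
    rw [← map_pow, neg_one_sq, map_one]
  rw [h2, h1, show (8 : ℕ) = 2 * 4 from rfl, pow_mul, gaussSum_sq hne hquad hψ, mul_pow,
    show (4 : ℕ) = 2 * 2 from rfl, pow_mul (η (-1)), h3]
  simp

end Classification

section Realisation

variable {K V F : Type*} [Field K] [Fintype K] [AddCommGroup V] [Module K V] [Field F] [Fintype F]
  [Algebra K F]

open QuadraticMap

/-- `normTrace` as a quadratic form. -/
noncomputable def normTraceForm (K F : Type*) [Field K] [Fintype K] [Field F] [Fintype F]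
    [Algebra K F] : QuadraticForm K F :=
  LinearMap.BilinMap.toQuadraticMap ((LinearMap.mul K F).compr₂ (Algebra.trace K F) |>.compl₂
    (FiniteField.frobeniusAlgEquivOfAlgebraic K F ^ 4).toLinearMap)

lemma normTraceForm_apply (x : F) : normTraceForm K F x = normTrace K x := by
  have h := congrFun (FiniteField.coe_frobeniusAlgEquivOfAlgebraic_iterate K F 4) x
  beta_reduce at h
  rw [← AlgEquiv.coe_pow] at h
  simp only [normTraceForm, LinearMap.BilinMap.toQuadraticMap_apply, LinearMap.compl₂_apply,
    AlgEquiv.toLinearMap_apply, h, LinearMap.compr₂_apply, LinearMap.mul_apply', normTrace]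
  rw [pow_succ' x]

lemma normTraceForm_polar (hF : Module.finrank K F = 8) (x y : F) :
    polar (normTraceForm K F) x y = 2 * Algebra.trace K F (x * y ^ Fintype.card K ^ 4) := by
  have h := trace_frob_mul hF (m := 4) (n := 4) rfl x y
  rw [polar, normTraceForm_apply, normTraceForm_apply, normTraceForm_apply, normTrace, normTrace,
    normTrace, pow_succ (x + y), pow_succ x, pow_succ y, frob_add, two_mul]
  nth_rw 1 [← h]
  rw [← map_sub, ← map_sub, ← map_add]
  congr 1
  ring

lemma exists_equivalent_cons_one_of_nondegenerate (hK : ringChar K ≠ 2)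
    (hV : Module.finrank K V = 8) (Q : QuadraticForm K V)
    (hQ : ∀ x, (∀ y, polar Q x y = 0) → x = 0) :
    ∃ d : K, d ≠ 0 ∧ Equivalent Q
      (weightedSumSquares K (Fin.cons d fun _ => 1 : Fin 8 → K)) := by
  have h2 : (2 : K) ≠ 0 := Ring.two_ne_zero hK
  have : Invertible (2 : K) := invertibleOfNonzero h2
  have : FiniteDimensional K V := FiniteDimensional.of_finrank_pos (by omega)
  have hsep : (associated (R := K) Q).SeparatingLeft := by
    intro x hx
    refine hQ x fun y => ?_
    have h1 := two_nsmul_associated K Q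
    have h2 := congrArg (fun B => B x y) h1
    simp only [LinearMap.smul_apply, polarBilin_apply_apply, hx y, smul_zero] at h2
    exact h2.symm
  obtain ⟨w, hw⟩ : ∃ w : Fin 8 → Kˣ, Equivalent Q (weightedSumSquares K w) := by
    rw [← hV]
    exact QuadraticForm.equivalent_weightedSumSquares_units_of_nondegenerate' Q hsep
  obtain ⟨d, hd, h⟩ := exists_equivalent_cons_one hK (fun i => (w i : K)) fun i => (w i).ne_zero
  exact ⟨d, hd, hw.trans h⟩

omit [Fintype K] in
lemma equivalent_sum_squares_of_isSquare {Q : QuadraticForm K V} {d : K} (hd : d ≠ 0)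
    (hsq : IsSquare d)
    (h : Equivalent Q (weightedSumSquares K (Fin.cons d fun _ => 1 : Fin 8 → K))) :
    Equivalent Q (weightedSumSquares K fun _ : Fin 8 => (1 : K)) := by
  obtain ⟨c, rfl⟩ := hsq
  have h1 := h.trans (equivalent_cons_of_isSquare (d' := 1) (left_ne_zero_of_mul hd)
    (by ring) fun _ => 1)
  have h3 : (Fin.cons 1 fun _ => 1 : Fin 8 → K) = fun _ => 1 := by
    ext i
    refine Fin.cases ?_ (fun i => ?_) i <;> simp
  rwa [h3] at h1

/-- Every elliptic form in dimension eight is equivalent to `x ↦ Tr (x ^ (q ^ 4 + 1))`, since both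
have nonsquare discriminant: for the given form because a sum of eight squares has a totally
singular subspace of dimension four, for the trace form because of the sign of its Gauss sum. -/
theorem exists_linearEquiv_normTrace (hK : ringChar K ≠ 2) (hV : Module.finrank K V = 8)
    (hF : Module.finrank K F = 8) (Q : QuadraticForm K V) (hQ : IsNonsingularElliptic Q)
    {E : Type*} [Field E] [CharZero E] {ψ : AddChar K E} (hψ : ψ.IsPrimitive) :
    ∃ φ : V ≃ₗ[K] F, ∀ x, Q x = normTrace K (φ x) := by
  have h2K : (2 : K) ≠ 0 := Ring.two_ne_zero hK
  have h2 : (2 : F) ≠ 0 := by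
    rw [← map_ofNat (algebraMap K F)]
    simpa using h2K
  obtain ⟨d, hd, hQd⟩ := exists_equivalent_cons_one_of_nondegenerate hK hV Q fun x hx =>
    hQ.1.1 x hx
  obtain ⟨d', hd', hQd'⟩ := exists_equivalent_cons_one_of_nondegenerate hK hF
    (normTraceForm K F) fun x hx => by
      by_contra hx0
      obtain ⟨a, ha⟩ := Algebra.trace_surjective K F 1
      have h1 := hx ((x⁻¹ * a) ^ Fintype.card K ^ 4)
      rw [normTraceForm_polar hF, frob_frob, ← zero_add (4 + 4), frob_eight hF, pow_zero, pow_one,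
        mul_inv_cancel_left₀ hx0, ha, mul_one] at h1
      exact h2K h1
  have hdns : ¬ IsSquare d := by
    intro hsq
    obtain ⟨W, hW, hW4⟩ := exists_totallySingular_of_sum_squares hK Q
      (equivalent_sum_squares_of_isSquare hd hsq hQd)
    obtain ⟨m, hm, hmax⟩ := hQ.2
    have := hmax.2 ⟨W, hW, hW4⟩
    omega
  have hdns' : ¬ IsSquare d' := by
    intro hsq
    obtain ⟨e⟩ := equivalent_sum_squares_of_isSquare hd' hsq hQd'
    have h1 := sum_traceChar_norm hF h2 hψ one_ne_zero (one_pow _)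
    have h3 : ∑ x : F, traceChar F ψ (1 * x ^ (Fintype.card K ^ 4 + 1)) =
        (Fintype.card K : E) ^ 4 := by
      rw [← sum_addChar_sum_squares hK hψ, ← Equiv.sum_comp e.toLinearEquiv.toEquiv]
      refine Finset.sum_congr rfl fun x _ => ?_
      have := e.map_app x
      rw [normTraceForm_apply] at this
      rw [one_mul, traceChar_apply]
      exact congrArg ψ this.symm
    rw [h1, neg_eq_iff_add_eq_zero, ← two_mul] at h3
    have : (Fintype.card K : E) ≠ 0 := Nat.cast_ne_zero.2 Fintype.card_ne_zero
    simp [this] at h3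
  obtain ⟨c, hc⟩ : IsSquare (d * d') := by
    classical
    rw [← quadraticChar_one_iff_isSquare (mul_ne_zero hd hd'), map_mul,
      quadraticChar_neg_one_iff_not_isSquare.2 hdns,
      quadraticChar_neg_one_iff_not_isSquare.2 hdns']
    norm_num
  have hc0 : c ≠ 0 := by
    rintro rfl
    exact mul_ne_zero hd hd' (by simpa using hc)
  obtain ⟨e⟩ := (hQd.trans (equivalent_cons_of_isSquare (d' := d') (div_ne_zero hc0 hd')
    (by field_simp; linear_combination -hc) _)).trans hQd'.symm
  exact ⟨e.toLinearEquiv, fun x => by rw [← normTraceForm_apply]; exact (e.map_app x).symm⟩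

end Realisation

/-! ### The decomposition -/

/-- The four parameters `r` and `1` sum up to `q ^ 4`, as they must since the four graphs decompose
the complete graph. -/
lemma sum_parameters {q : ℕ} (hodd : Odd q) :
    q ^ 3 * ((q - 1) / 2) + (q ^ 2 - 1) + q ^ 3 * ((q - 1) / 2) + q ^ 2 * (q - 1) + 1 = q ^ 4 := by
  obtain ⟨h, rfl⟩ := hodd
  have h1 : (2 * h + 1) ^ 2 - 1 = 4 * h ^ 2 + 4 * h := by
    rw [show (2 * h + 1) ^ 2 = 4 * h ^ 2 + 4 * h + 1 by ring, Nat.add_sub_cancel]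
  rw [h1, Nat.add_sub_cancel, Nat.mul_div_cancel_left _ two_pos]
  ring

lemma isConnectionSet_of_neg {V : Type*} [AddGroup V] {D : Set V} (h0 : (0 : V) ∉ D)
    (h : ∀ x ∈ D, -x ∈ D) : IsConnectionSet D :=
  ⟨h0, fun x => ⟨h x, fun hx => neg_neg x ▸ h _ hx⟩⟩

theorem mainTheorem1 {K V F : Type*} [Field K] [Fintype K]
    [AddCommGroup V] [Module K V] [Fintype V] [Field F] [Algebra K F]
    (q : ℕ) (hq : Fintype.card K = q) (hodd : Odd q)
    (hV : Module.finrank K V = 8) (hF : Module.finrank K F = 8)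
    (Q : QuadraticForm K V) (hQ : IsNonsingularElliptic Q)
    (γ : Fˣ) (hγ : ∀ y : Fˣ, y ∈ Subgroup.zpowers γ) :
    (∃ φ : V ≃ₗ[K] F, ∀ x, Q x = Algebra.trace K F (φ x ^ (q ^ 4 + 1))) ∧
    ∀ φ : V ≃ₗ[K] F, (∀ x, Q x = Algebra.trace K F (φ x ^ (q ^ 4 + 1))) →
      let D₁ : Set V := affinePolarSet Q
      let D₂ : Set V := φ ⁻¹' cyclotomicClass γ (q ^ 2 + 1) ((q ^ 2 + 1) / 2)
      let D₃ : Set V := {x | x ∉ ({0} ∪ singularVectors Q ∪ D₁ : Set V)}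
      let D₄ : Set V := singularVectors Q \ D₂
      let G₁ := SimpleGraph.addCayley D₁
      let G₂ := SimpleGraph.addCayley D₂
      let G₃ := SimpleGraph.addCayley D₃
      let G₄ := SimpleGraph.addCayley D₄
      (IsConnectionSet D₁ ∧ IsConnectionSet D₂ ∧ IsConnectionSet D₃ ∧ IsConnectionSet D₄) ∧
      IsDecompositionOfComplete ![G₁, G₂, G₃, G₄] ∧
      IsNegLatinSquareSRG G₁ (q ^ 4) (q ^ 3 * ((q - 1) / 2)) ∧
      IsNegLatinSquareSRG G₂ (q ^ 4) (q ^ 2 - 1) ∧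
      IsNegLatinSquareSRG G₃ (q ^ 4) (q ^ 3 * ((q - 1) / 2)) ∧
      IsNegLatinSquareSRG G₄ (q ^ 4) (q ^ 2 * (q - 1)) ∧
      IsNegLatinSquareSRG (G₁ ⊔ G₃) (q ^ 4) (q ^ 3 * (q - 1)) ∧
      IsNegLatinSquareSRG (G₁ ⊔ G₂) (q ^ 4) (q ^ 3 * ((q - 1) / 2) + (q ^ 2 - 1)) ∧
      IsNegLatinSquareSRG (G₂ ⊔ G₃) (q ^ 4) (q ^ 3 * ((q - 1) / 2) + (q ^ 2 - 1)) ∧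
      (q = 3 → IsSRG (G₁ ⊔ G₂) (3 ^ 8) 2870 1249 1260 ∧
        IsSRG (G₂ ⊔ G₃) (3 ^ 8) 2870 1249 1260) := by
  classical
  subst hq
  have : Module.Finite K F := FiniteDimensional.of_finrank_pos (by omega)
  have : Finite F := Module.finite_of_finite K
  let := Fintype.ofFinite F
  have hK : ringChar K ≠ 2 := fun h => by
    have := FiniteField.even_card_of_char_two h
    rw [Nat.odd_iff] at hodd
    omega
  have h2 : (2 : F) ≠ 0 := by
    rw [← map_ofNat (algebraMap K F)]
    simpa using Ring.two_ne_zero hK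
  have hchar : ringChar ℚ ≠ ringChar K := by
    rw [ringChar.eq_zero]
    exact (CharP.char_ne_zero_of_finite K (ringChar K)).symm
  have hψ := (AddChar.FiniteField.primitiveChar K ℚ hchar).prim
  set ψ := (AddChar.FiniteField.primitiveChar K ℚ hchar).char
  refine ⟨exists_linearEquiv_normTrace hK hV hF Q hQ hψ, fun φ hφ => ?_⟩
  intro D₁ D₂ D₃ D₄ G₁ G₂ G₃ G₄
  set q := Fintype.card K
  replace hφ : ∀ x, Q x = normTrace K (φ x) := hφ
  have hq3 : 3 ≤ q := by
    have : 1 < q := Fintype.one_lt_card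
    obtain ⟨h, hh⟩ := hodd
    omega
  -- the four sets in terms of `normTrace` and `relSingular`
  have m₁ : ∀ x, x ∈ D₁ ↔ quadraticChar K (Q x) = 1 := by
    intro x
    constructor
    · exact fun hx => (quadraticChar_one_iff_isSquare hx.1).2 hx.2
    · intro hx
      have h0 : Q x ≠ 0 := fun h => by simp [h] at hx
      exact ⟨h0, (quadraticChar_one_iff_isSquare h0).1 hx⟩
  have hD₂ : D₂ = φ ⁻¹' relSingular K := by
    rw [← cyclotomicClass_eq_relSingular hF hodd γ hγ]
  have m₂ : ∀ x ∈ D₂, x ≠ 0 ∧ Q x = 0 := by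
    intro x hx
    rw [hD₂] at hx
    exact ⟨fun h => hx.1 (by rw [h, map_zero]),
      (hφ x).trans (normTrace_eq_zero_of_mem_relSingular h2 hx)⟩
  have m₃ : ∀ x, x ∈ D₃ ↔ quadraticChar K (Q x) = -1 := by
    intro x
    have h1 : x ∈ D₃ ↔ ¬ ((x = 0 ∨ (x ≠ 0 ∧ Q x = 0)) ∨ x ∈ D₁) := Iff.rfl
    rw [h1, m₁]
    by_cases h0 : Q x = 0
    · simp [h0, em]
    · have hx : x ≠ 0 := fun h => h0 (by rw [h, map_zero])
      rcases quadraticChar_dichotomy h0 with h | h <;> simp [h0, hx, h]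
  have hD₁ : D₁ = φ ⁻¹' normTraceClass K 1 1 := by
    ext x
    rw [m₁, Set.mem_preimage, mem_normTraceClass, one_mul, hφ]
  have hD₃ : D₃ = φ ⁻¹' normTraceClass K 1 (-1) := by
    ext x
    rw [m₃, Set.mem_preimage, mem_normTraceClass, one_mul, hφ]
  have hD₄ : D₄ = {x | x ≠ 0 ∧ x ∉ D₁ ∪ D₂ ∪ D₃} := by
    ext x
    have h1 : x ∈ D₄ ↔ (x ≠ 0 ∧ Q x = 0) ∧ x ∉ D₂ := Iff.rfl
    have h3 : x ∈ D₁ ∪ D₂ ∪ D₃ ↔ (x ∈ D₁ ∨ x ∈ D₂) ∨ x ∈ D₃ := Iff.rfl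
    rw [h1, Set.mem_ofPred_eq, h3, m₁, m₃]
    by_cases h0 : Q x = 0
    · simp [h0]
    · rcases quadraticChar_dichotomy h0 with h | h <;> simp [h0, h]
  -- disjointness
  have d₁₂ : Disjoint D₁ D₂ := Set.disjoint_left.2 fun x h h' => by
    have := (m₁ x).1 h
    simp [(m₂ x h').2] at this
  have d₃₂ : Disjoint D₃ D₂ := Set.disjoint_left.2 fun x h h' => by
    have := (m₃ x).1 h
    simp [(m₂ x h').2] at this
  have d₁₃ : Disjoint D₁ D₃ := Set.disjoint_left.2 fun x h h' => by
    have := (m₁ x).1 h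
    rw [(m₃ x).1 h'] at this
    norm_num at this
  have d₄ : Disjoint (D₁ ∪ D₂ ∪ D₃) D₄ := by
    rw [hD₄]
    exact Set.disjoint_left.2 fun x h h' => h'.2 h
  have d₁₄ : Disjoint D₁ D₄ := d₄.mono_left fun x h => Or.inl (Or.inl h)
  have d₂₄ : Disjoint D₂ D₄ := d₄.mono_left fun x h => Or.inl (Or.inr h)
  have d₃₄ : Disjoint D₃ D₄ := d₄.mono_left fun x h => Or.inr h
  -- connection sets
  have c₁ : IsConnectionSet D₁ := isConnectionSet_of_neg (fun h => by simpa using (m₁ 0).1 h)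
    fun x hx => by rwa [m₁, QuadraticMap.map_neg, ← m₁]
  have c₃ : IsConnectionSet D₃ := isConnectionSet_of_neg (fun h => by simpa using (m₃ 0).1 h)
    fun x hx => by rwa [m₃, QuadraticMap.map_neg, ← m₃]
  have c₂ : IsConnectionSet D₂ := isConnectionSet_of_neg (fun h => (m₂ 0 h).1 rfl) fun x hx => by
    rw [hD₂] at hx ⊢
    refine ⟨fun h => hx.1 ?_, ?_⟩
    · rwa [map_neg, neg_eq_zero] at h
    · rw [map_neg, (hodd.pow.add_one).neg_pow]
      exact hx.2
  have c₄ : IsConnectionSet D₄ := by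
    rw [hD₄]
    exact ((c₁.union c₂).union c₃).compl
  -- Fourier transforms
  have hX : Fintype.card V = (q ^ 4) ^ 2 := by
    rw [Module.card_eq_pow_finrank (K := K) (V := V), hV, ← pow_mul]
  have hχ := (polarChar_isOrthogonalFamily hF h2 hψ).preimage φ.toAddEquiv
  have s₁ := (normTraceClass_spectrum hF h2 hψ hK (Or.inl rfl)).preimage φ.toAddEquiv
  have s₂ := (relSingular_spectrum hF h2 hψ).preimage φ.toAddEquiv
  have s₃ := (normTraceClass_spectrum hF h2 hψ hK (Or.inr rfl)).preimage φ.toAddEquiv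
  set χ := fun w => (polarChar ψ w).compAddMonoidHom φ.toAddEquiv.toAddMonoidHom
  replace s₁ : HasNegLatinSpectrum χ D₁ _ (q ^ 4) _ := hD₁ ▸ s₁
  replace s₂ : HasNegLatinSpectrum χ D₂ _ (q ^ 4) _ := hD₂ ▸ s₂
  replace s₃ : HasNegLatinSpectrum χ D₃ _ (q ^ 4) _ := hD₃ ▸ s₃
  have e₁₂ : ∀ a s, s ≠ 0 → Disjoint (normTraceClass K a s : Set F) (relSingular K) :=
    fun a s hs => Set.disjoint_left.2 fun x h h' => by
      rw [mem_normTraceClass, normTrace_eq_zero_of_mem_relSingular h2 h', mul_zero,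
        MulChar.map_zero] at h
      exact hs h.symm
  have e₁₃ : Disjoint (normTraceClass K (-1) 1 : Set F) (normTraceClass K (-1) (-1)) :=
    Set.disjoint_left.2 fun x h h' => by
      rw [mem_normTraceClass] at h h'
      rw [h] at h'
      norm_num at h'
  have s₁₂ := s₁.union s₂ d₁₂ (e₁₂ _ _ (by norm_num))
  have s₁₃ := s₁.union s₃ d₁₃ e₁₃
  have s₂₃ := s₂.union s₃ d₃₂.symm (e₁₂ _ _ (by norm_num)).symm
  have s₁₂₃ := s₁₂.union s₃ (d₁₃.sup_left d₃₂.symm)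
    (e₁₃.sup_left (e₁₂ _ _ (by norm_num)).symm)
  have hsum := sum_parameters hodd
  have s₄ := s₁₂₃.compl hχ hX ((c₁.union c₂).union c₃).1 hsum
  rw [← hD₄] at s₄
  have r₁ : 0 < q ^ 3 * ((q - 1) / 2) := Nat.mul_pos (by positivity) (by omega)
  have r₂ : 0 < q ^ 2 - 1 := by
    have : 1 < q ^ 2 := Nat.one_lt_pow two_ne_zero (by omega)
    omega
  have r₄ : 0 < q ^ 2 * (q - 1) := Nat.mul_pos (by positivity) (by omega)
  have hr₁₃ : q ^ 3 * (q - 1) = q ^ 3 * ((q - 1) / 2) + q ^ 3 * ((q - 1) / 2) := by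
    have : q - 1 = (q - 1) / 2 + (q - 1) / 2 := by
      obtain ⟨h, hh⟩ := hodd
      omega
    rw [← mul_add, ← this]
  have g₁₂ : IsNegLatinSquareSRG (G₁ ⊔ G₂) (q ^ 4) (q ^ 3 * ((q - 1) / 2) + (q ^ 2 - 1)) := by
    rw [← SimpleGraph.addCayley_union]
    exact s₁₂.isNegLatinSquareSRG hχ hX (c₁.union c₂) (by omega) (by omega)
  have g₂₃ : IsNegLatinSquareSRG (G₂ ⊔ G₃) (q ^ 4) (q ^ 3 * ((q - 1) / 2) + (q ^ 2 - 1)) := by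
    rw [← SimpleGraph.addCayley_union, add_comm]
    exact s₂₃.isNegLatinSquareSRG hχ hX (c₂.union c₃) (by omega) (by omega)
  refine ⟨⟨c₁, c₂, c₃, c₄⟩, ?_, s₁.isNegLatinSquareSRG hχ hX c₁ r₁ (by omega),
    s₂.isNegLatinSquareSRG hχ hX c₂ r₂ (by omega), s₃.isNegLatinSquareSRG hχ hX c₃ r₁ (by omega),
    s₄.isNegLatinSquareSRG hχ hX c₄ r₄ (by omega), ?_, g₁₂, g₂₃, fun h3 => ?_⟩
  · have hfam : ![G₁, G₂, G₃, G₄] = fun i => SimpleGraph.addCayley (![D₁, D₂, D₃, D₄] i) := by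
      ext1 i
      fin_cases i <;> rfl
    rw [hfam]
    refine isDecompositionOfComplete_addCayley ?_ ?_ fun x hx => ?_
    · intro i
      fin_cases i
      exacts [c₁, c₂, c₃, c₄]
    · intro i j hij
      fin_cases i <;> fin_cases j <;>
        first
        | exact absurd rfl hij
        | assumption
        | (apply Disjoint.symm; assumption)
    · by_cases h : x ∈ D₁ ∪ D₂ ∪ D₃
      · rcases h with (h | h) | h
        exacts [⟨0, h⟩, ⟨1, h⟩, ⟨2, h⟩]
      · exact ⟨3, show x ∈ D₄ by rw [hD₄]; exact ⟨hx, h⟩⟩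
  · rw [← SimpleGraph.addCayley_union, hr₁₃]
    exact s₁₃.isNegLatinSquareSRG hχ hX (c₁.union c₃) (by omega) (by omega)
  · rw [h3] at g₁₂ g₂₃
    obtain ⟨l, hl, g₁₂⟩ := g₁₂
    obtain ⟨l', hl', g₂₃⟩ := g₂₃
    norm_num at hl hl' g₁₂ g₂₃
    obtain rfl : l = 1249 := by exact_mod_cast hl
    obtain rfl : l' = 1249 := by exact_mod_cast hl'
    norm_num
    exact ⟨g₁₂, g₂₃⟩
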